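/- Let $Q$ be a commutative ring, $\boldsymbol f=f_1,\dots,f_n$ and $\boldsymbol f'=f_1',\dots,f_n'$ two lists of elements of $Q$, $I\subseteq Q$ an ideal containing all $f_i$ and $f_i'$, and $R=Q/I$. Let $E=Q\langle \xi_1,\dots,\xi_n\mid \partial\xi_i=f_i\rangle$ and $E'=Q\langle \xi'_1,\dots,\xi'_n\mid \partial\xi'_i=f'_i\rangle$ be the Koszul complexes and $\Lambda=E\otimes_Q E'$. Let $\mathcal P=R[\chi_1,\dots,\chi_n]$ be the polynomial ring with zero differential and each $\chi_i$ of homological degree $-2$, and let $\mathcal D=\operatorname{Hom}_R(\mathcal P,R)$ be its graded $R$-linear dual, with $(p\varphi)(q)=\varphi(pq)$. A DG module $P$ over a DG algebra $A$ is semiprojective if for every morphism $\alpha:P\to Y$ and every surjective quasi-isomorphism $\gamma:X\to Y$ of DG $A$-modules there is a morphism $\beta:P\to X$ with $\gamma\beta=\alpha$, unique up to homotopy; a semiprojective resolution of a DG $A$-module $M$ is a surjective quasi-isomorphism $P\to M$ of DG $A$-modules with $P$ semiprojective. Let $M$ be an $R$-module with $f_i-f'_i\in I\cdot\operatorname{ann}_Q(M)$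 for each $i$. A strong $\Lambda$-resolution of $M$ is obtained as follows: write $f_i-f'_i=\sum_j x_{i,j}g_{i,j}$ (finite sums) with $x_{i,j}\in I$ and $g_{i,j}\in\operatorname{ann}_Q(M)$, put $B=\Lambda\langle\zeta_{i,j}\mid\partial\zeta_{i,j}=g_{i,j}\rangle$ (exterior variables of degree $1$), regard $M$ as a DG $B$-module concentrated in degree $0$ on which all $\xi_i,\xi'_i,\zeta_{i,j}$ act as $0$, and take a bounded below semiprojective resolution $F\to M$ over $B$. Then for every strong $\Lambda$-resolution $F\to M$ (for any choice of the $x_{i,j},g_{i,j}$) there is an isomorphism of DG $\mathcal P\otimes_Q\Lambda$-modules $$(\mathcal D\otimes_Q F)^{\delta}\;\cong\;(\mathcal D\otimes_Q F)^{\varepsilon},\qquad \delta=\sum_{i=1}^n\chi_i\otimes\lambda_i,\quad \varepsilon=\sum_{i=1}^n\chi_i\otimes\lambda'_i,$$ where $\lambda_i$ and $\lambda'_i$ denote left multiplication by $\xi_i$ and $\xi'_i$ on $F$, and $X^{\delta}$ denotes the graded module $X$ with the differential $\partial^X+\delta$. -/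

import Mathlib

open scoped TensorProduct

universe u

noncomputable section

/-! ### Gradings -/

/-- A criterion for a family of submodules to be the pieces of a direct sum decomposition. -/
theorem isInternal_of_detect {Q : Type*} [CommRing Q] {X : Type*} [AddCommGroup X] [Module Q X]
    {κ : Type*} [DecidableEq κ] (G : κ → Submodule Q X) (hG : ⨆ i, G i = ⊤)
    {Y : κ → Type*} [∀ i, AddCommGroup (Y i)] [∀ i, Module Q (Y i)] (c : ∀ i, X →ₗ[Q] Y i)
    (h1 : ∀ i j, j ≠ i → ∀ x ∈ G j, c i x = 0) (h2 : ∀ i, ∀ x ∈ G i, c i x = 0 → x = 0) :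
    DirectSum.IsInternal G := by
  refine DirectSum.isInternal_submodule_of_iSupIndep_of_iSup_eq_top ?_ hG
  refine iSupIndep_of_dfinsupp_lsum_injective _ ?_
  rw [← LinearMap.ker_eq_bot, LinearMap.ker_eq_bot']
  intro v hv
  have key : ∀ w : Π₀ i, G i, ∀ i,
      c i (DFinsupp.lsum ℕ (fun i => (G i).subtype) w) = c i (w i) := by
    intro w i
    induction w using DFinsupp.induction with
    | h0 => simp
    | ha j b w _ _ ih =>
      simp only [map_add, ih, DFinsupp.add_apply, Submodule.coe_add]
      congr 1
      rw [DFinsupp.lsum_single, Submodule.subtype_apply]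
      by_cases h : j = i
      · subst h; simp
      · rw [h1 i j h b b.2, DFinsupp.single_eq_of_ne (Ne.symm h), Submodule.coe_zero, map_zero]
  ext i
  have := key v i
  rw [hv, map_zero] at this
  simpa using h2 i _ (v i).2 this.symm

theorem isInternal_of_coaction {Q : Type*} [CommRing Q] {X : Type*} [AddCommGroup X] [Module Q X]
    {κ : Type*} [DecidableEq κ] (G : κ → Submodule Q X) (hG : ⨆ i, G i = ⊤)
    (c : X →ₗ[Q] (κ →₀ X)) (hc : ∀ i, ∀ x ∈ G i, c x = Finsupp.single i x) :
    DirectSum.IsInternal G := by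
  refine isInternal_of_detect G hG (fun i => (Finsupp.lapply i).comp c) ?_ ?_
  · intro i j h x hx
    simp [hc j x hx, Finsupp.single_eq_of_ne (Ne.symm h)]
  · intro i x hx h
    simpa [hc i x hx] using h

/-- Conversely, a decomposition gives the map sending `x` of degree `i` to `x` placed at `i`. -/
theorem exists_coaction {Q : Type*} [CommRing Q] {X : Type*} [AddCommGroup X] [Module Q X]
    {κ : Type*} [DecidableEq κ] (G : κ → Submodule Q X) (h : DirectSum.IsInternal G) :
    ∃ c : X →ₗ[Q] (κ →₀ X), ∀ i, ∀ x ∈ G i, c x = Finsupp.single i x := by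
  let e := LinearEquiv.ofBijective (DirectSum.coeLinearMap G) h
  refine ⟨(DirectSum.toModule Q κ (κ →₀ X)
    (fun i => (Finsupp.lsingle i).comp (G i).subtype)).comp e.symm.toLinearMap, ?_⟩
  intro i x hx
  have : e.symm x = DirectSum.lof Q κ (fun i => G i) i ⟨x, hx⟩ := by
    rw [LinearEquiv.symm_apply_eq]
    exact (DirectSum.coeLinearMap_lof G i ⟨x, hx⟩).symm
  simp [this]

/-- The total grading on a tensor product: degree `k` is spanned by the `x ⊗ y` with
`|x| + |y| = k`. -/
def tensorGrading {Q : Type*} [CommRing Q] {X Y : Type*} [AddCommGroup X] [Module Q X]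
    [AddCommGroup Y] [Module Q Y] (G : ℤ → Submodule Q X) (H : ℤ → Submodule Q Y) (k : ℤ) :
    Submodule Q (X ⊗[Q] Y) :=
  Submodule.span Q {t | ∃ i j : ℤ, i + j = k ∧ ∃ x ∈ G i, ∃ y ∈ H j, t = x ⊗ₜ[Q] y}

theorem isInternal_tensorGrading {Q : Type*} [CommRing Q] {X Y : Type*} [AddCommGroup X]
    [Module Q X] [AddCommGroup Y] [Module Q Y] (G : ℤ → Submodule Q X) (H : ℤ → Submodule Q Y)
    (hG : DirectSum.IsInternal G) (hH : DirectSum.IsInternal H) :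
    DirectSum.IsInternal (tensorGrading G H) := by
  obtain ⟨c, hc⟩ := exists_coaction G hG
  obtain ⟨c', hc'⟩ := exists_coaction H hH
  refine isInternal_of_coaction _ ?_
    ((Finsupp.lmapDomain (X ⊗[Q] Y) Q (fun p : ℤ × ℤ => p.1 + p.2)).comp
      ((finsuppTensorFinsupp Q Q X Y ℤ ℤ).toLinearMap.comp (TensorProduct.map c c'))) ?_
  · rw [eq_top_iff]
    rintro t -
    induction t with
    | zero => exact zero_mem _
    | add a b ha hb => exact add_mem ha hb
    | tmul x y =>
      have hx : x ∈ ⨆ i, G i := by rw [hG.submodule_iSup_eq_top]; trivial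
      have hy : y ∈ ⨆ i, H i := by rw [hH.submodule_iSup_eq_top]; trivial
      induction hx using Submodule.iSup_induction' with
      | zero => rw [TensorProduct.zero_tmul]; exact zero_mem _
      | add a b _ _ ha hb => rw [TensorProduct.add_tmul]; exact add_mem ha hb
      | mem i x hx =>
        induction hy using Submodule.iSup_induction' with
        | zero => rw [TensorProduct.tmul_zero]; exact zero_mem _
        | add a b _ _ ha hb => rw [TensorProduct.tmul_add]; exact add_mem ha hb
        | mem j y hy =>
          exact Submodule.mem_iSup_of_mem (i + j)
            (Submodule.subset_span ⟨i, j, rfl, x, hx, y, hy, rfl⟩)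
  · intro k t ht
    induction ht using Submodule.span_induction with
    | zero => simp
    | add a b _ _ ha hb => rw [map_add, ha, hb, Finsupp.single_add]
    | smul q a _ ha => rw [map_smul, ha, Finsupp.smul_single]
    | mem t ht =>
      obtain ⟨i, j, rfl, x, hx, y, hy, rfl⟩ := ht
      simp [hc i x hx, hc' j y hy, Finsupp.mapDomain_single]

/-! ### DG algebras and DG modules -/

/-- A graded-commutative DG `Q`-algebra, with homological grading `gr` over `ℤ`
and differential `d` of degree `-1`. -/
structure DGAlgebra (Q : Type u) [CommRing Q] where
  carrier : Type u
  [ring : Ring carrier]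
  [algebra : Algebra Q carrier]
  gr : ℤ → Submodule Q carrier
  internal : DirectSum.IsInternal gr
  one_mem : (1 : carrier) ∈ gr 0
  mul_mem : ∀ i j : ℤ, ∀ a ∈ gr i, ∀ b ∈ gr j, a * b ∈ gr (i + j)
  graded_comm : ∀ i j : ℤ, ∀ a ∈ gr i, ∀ b ∈ gr j, a * b = (i * j).negOnePow • (b * a)
  d : carrier →ₗ[Q] carrier
  d_mem : ∀ i : ℤ, ∀ a ∈ gr i, d a ∈ gr (i - 1)
  d_d : ∀ a, d (d a) = 0
  leibniz : ∀ i : ℤ, ∀ a ∈ gr i, ∀ b, d (a * b) = d a * b + i.negOnePow • (a * d b)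

attribute [instance] DGAlgebra.ring DGAlgebra.algebra

instance {Q : Type u} [CommRing Q] : CoeSort (DGAlgebra Q) (Type u) := ⟨DGAlgebra.carrier⟩

/-- A (left) DG module over the DG algebra `A`. -/
structure DGModule {Q : Type u} [CommRing Q] (A : DGAlgebra Q) where
  carrier : Type u
  [addCommGroup : AddCommGroup carrier]
  [module : Module Q carrier]
  [moduleAlg : Module A carrier]
  [tower : IsScalarTower Q A carrier]
  gr : ℤ → Submodule Q carrier
  internal : DirectSum.IsInternal gr
  smul_mem : ∀ i j : ℤ, ∀ a ∈ A.gr i, ∀ x ∈ gr j, a • x ∈ gr (i + j)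
  d : carrier →ₗ[Q] carrier
  d_mem : ∀ i : ℤ, ∀ x ∈ gr i, d x ∈ gr (i - 1)
  d_d : ∀ x, d (d x) = 0
  leibniz : ∀ i : ℤ, ∀ a ∈ A.gr i, ∀ x, d (a • x) = A.d a • x + i.negOnePow • (a • d x)

attribute [instance] DGModule.addCommGroup DGModule.module DGModule.moduleAlg DGModule.tower

instance {Q : Type u} [CommRing Q] (A : DGAlgebra Q) : CoeSort (DGModule A) (Type u) :=
  ⟨DGModule.carrier⟩

namespace DGModule

variable {Q : Type u} [CommRing Q] {A : DGAlgebra Q}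

/-- `φ` is a degree `e` map of DG `A`-modules, that is, an element of `Hom_A(X, Y)_e`. -/
def IsDegreeMap (X Y : DGModule A) (e : ℤ) (φ : X →ₗ[Q] Y) : Prop :=
  (∀ i : ℤ, ∀ x ∈ X.gr i, φ x ∈ Y.gr (i + e)) ∧
    ∀ j : ℤ, ∀ a ∈ A.gr j, ∀ x, φ (a • x) = (e * j).negOnePow • (a • φ x)

/-- Morphisms of DG `A`-modules: degree `0` maps commuting with the differentials. -/
structure Hom (X Y : DGModule A) where
  map : X →ₗ[Q] Y
  isDegreeMap : IsDegreeMap X Y 0 map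
  comm : ∀ x, map (X.d x) = Y.d (map x)

/-- Isomorphisms of DG `A`-modules. -/
structure Iso (X Y : DGModule A) where
  hom : Hom X Y
  inv : Hom Y X
  hom_inv : ∀ x, inv.map (hom.map x) = x
  inv_hom : ∀ y, hom.map (inv.map y) = y

/-- Two morphisms are homotopic if their difference is `∂τ + τ∂` with `τ ∈ Hom_A(X, Y)_1`. -/
def Homotopic {X Y : DGModule A} (α β : Hom X Y) : Prop :=
  ∃ τ : X →ₗ[Q] Y, IsDegreeMap X Y 1 τ ∧ ∀ x, Y.d (τ x) + τ (X.d x) = α.map x - β.map x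

/-- The homology of `X`: cycles modulo boundaries. -/
abbrev Homology (X : DGModule A) : Type u :=
  LinearMap.ker X.d ⧸ (LinearMap.range X.d).submoduleOf (LinearMap.ker X.d)

/-- The map induced on cycles. -/
def Hom.cyclesMap {X Y : DGModule A} (α : Hom X Y) : LinearMap.ker X.d →ₗ[Q] LinearMap.ker Y.d :=
  α.map.restrict fun x hx => by
    rw [LinearMap.mem_ker] at hx ⊢
    rw [← α.comm, hx, map_zero]

/-- The map induced on homology. -/
def Hom.homologyMap {X Y : DGModule A} (α : Hom X Y) : X.Homology →ₗ[Q] Y.Homology :=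
  Submodule.mapQ _ _ α.cyclesMap fun x hx => by
    obtain ⟨w, hw⟩ := hx
    exact ⟨α.map w, by rw [← α.comm, hw]; rfl⟩

/-- Quasi-isomorphisms. -/
def Hom.IsQuasiIso {X Y : DGModule A} (α : Hom X Y) : Prop :=
  Function.Bijective α.homologyMap

/-- `P` is semiprojective: morphisms from `P` lift through surjective quasi-isomorphisms,
uniquely up to homotopy. -/
def IsSemiprojective (P : DGModule A) : Prop :=
  ∀ (X Y : DGModule A) (α : Hom P Y) (γ : Hom X Y),
    Function.Surjective γ.map → γ.IsQuasiIso →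
      ∃ β : Hom P X, (∀ x, γ.map (β.map x) = α.map x) ∧
        ∀ β' : Hom P X, (∀ x, γ.map (β'.map x) = α.map x) → Homotopic β' β

/-- `X_i = 0` for all sufficiently small `i`. -/
def BoundedBelow (X : DGModule A) : Prop :=
  ∃ N : ℤ, ∀ i < N, X.gr i = ⊥

/-- The perturbation `X^δ` of `X` by a `δ ∈ Z_{-1}(Hom_A(X, X))` with `δ² = 0`: the same graded
module with differential `∂ + δ`. -/
def perturb (X : DGModule A) (δ : X →ₗ[Q] X) (hδ : IsDegreeMap X X (-1) δ)
    (hcyc : ∀ x, X.d (δ x) + δ (X.d x) = 0) (hsq : ∀ x, δ (δ x) = 0) : DGModule A where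
  carrier := X
  gr := X.gr
  internal := X.internal
  smul_mem := X.smul_mem
  d := X.d + δ
  d_mem i x hx := add_mem (X.d_mem i x hx) (hδ.1 i x hx)
  d_d x := by
    simp only [LinearMap.add_apply, map_add, X.d_d, hsq, zero_add, add_zero]
    rw [add_comm]
    exact hcyc x
  leibniz i a ha x := by
    simp only [LinearMap.add_apply, X.leibniz i a ha, hδ.2 i a ha, smul_add]
    rw [show (-1 * i) = -i by ring, Int.negOnePow_neg]
    abel

end DGModule

/-- Morphisms of DG algebras. -/
structure DGAlgebra.Hom {Q : Type u} [CommRing Q] (A B : DGAlgebra Q) where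
  map : A →ₐ[Q] B
  map_mem : ∀ i : ℤ, ∀ a ∈ A.gr i, map a ∈ B.gr i
  comm : ∀ a, map (A.d a) = B.d (map a)

/-- Restriction of scalars along a morphism of DG algebras. -/
def DGModule.restrictScalars {Q : Type u} [CommRing Q] {A B : DGAlgebra Q} (φ : DGAlgebra.Hom A B)
    (X : DGModule B) : DGModule A :=
  letI : Module A X := Module.compHom X (φ.map : A →+* B)
  haveI : IsScalarTower Q A X := ⟨fun q a x => by
    change φ.map (q • a) • x = q • (φ.map a • x)
    rw [map_smul, smul_assoc]⟩
  { carrier := X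
    gr := X.gr
    internal := X.internal
    smul_mem := fun i j a ha x hx => X.smul_mem i j (φ.map a) (φ.map_mem i a ha) x hx
    d := X.d
    d_mem := X.d_mem
    d_d := X.d_d
    leibniz := fun i a ha x => by
      have := X.leibniz i (φ.map a) (φ.map_mem i a ha) x
      rw [← φ.comm] at this
      exact this }

/-! ### Tensor products with an evenly graded factor

If `S` is concentrated in even degrees, the sign `(-1)^{|a||s|}` in the product
`(t ⊗ a)(s ⊗ b) = (-1)^{|a||s|} ts ⊗ ab` is trivial and so is the differential of `S`; the same
holds for the action on `T ⊗ X` and its differential, if `T` is concentrated in even degrees. -/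

/-- `S` is concentrated in even degrees. -/
def DGAlgebra.IsEven {Q : Type u} [CommRing Q] (S : DGAlgebra Q) : Prop :=
  ∀ i : ℤ, Odd i → S.gr i = ⊥

/-- `T` is concentrated in even degrees. -/
def DGModule.IsEven {Q : Type u} [CommRing Q] {S : DGAlgebra Q} (T : DGModule S) : Prop :=
  ∀ i : ℤ, Odd i → T.gr i = ⊥

/-- The DG algebra `S ⊗_Q A`, for `S` concentrated in even degrees. -/
def DGAlgebra.tensor {Q : Type u} [CommRing Q] (S : DGAlgebra Q) (hS : S.IsEven)
    (A : DGAlgebra Q) : DGAlgebra Q where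
  carrier := S ⊗[Q] A
  gr := tensorGrading S.gr A.gr
  internal := isInternal_tensorGrading _ _ S.internal A.internal
  one_mem := Submodule.subset_span ⟨0, 0, rfl, 1, S.one_mem, 1, A.one_mem, rfl⟩
  mul_mem := by
    intro i j a ha b hb
    induction ha using Submodule.span_induction with
    | zero => rw [zero_mul]; exact zero_mem _
    | add a a' _ _ h h' => rw [add_mul]; exact add_mem h h'
    | smul q a _ h => rw [smul_mul_assoc]; exact Submodule.smul_mem _ _ h
    | mem a ha =>
      obtain ⟨i₁, i₂, rfl, s, hs, a, ha, rfl⟩ := ha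
      induction hb using Submodule.span_induction with
      | zero => rw [mul_zero]; exact zero_mem _
      | add a a' _ _ h h' => rw [mul_add]; exact add_mem h h'
      | smul q a _ h => rw [mul_smul_comm]; exact Submodule.smul_mem _ _ h
      | mem b hb =>
        obtain ⟨j₁, j₂, rfl, t, ht, b, hb, rfl⟩ := hb
        exact Submodule.subset_span ⟨i₁ + j₁, i₂ + j₂, by ring, s * t, S.mul_mem _ _ s hs t ht,
          a * b, A.mul_mem _ _ a ha b hb, Algebra.TensorProduct.tmul_mul_tmul _ _ _ _⟩
  graded_comm := by
    intro i j a ha b hb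
    induction ha using Submodule.span_induction with
    | zero => simp
    | add a a' _ _ h h' => rw [add_mul, mul_add, h, h', smul_add]
    | smul q a _ h => rw [smul_mul_assoc, mul_smul_comm, h, smul_comm]
    | mem a ha =>
      obtain ⟨i₁, i₂, rfl, s, hs, a, ha, rfl⟩ := ha
      induction hb using Submodule.span_induction with
      | zero => simp
      | add a a' _ _ h h' => rw [add_mul _ _ (s ⊗ₜ[Q] _), mul_add, h, h', smul_add]
      | smul q a _ h => rw [smul_mul_assoc, mul_smul_comm, h, smul_comm]
      | mem b hb =>
        obtain ⟨j₁, j₂, rfl, t, ht, b, hb, rfl⟩ := hb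
        rw [Algebra.TensorProduct.tmul_mul_tmul, Algebra.TensorProduct.tmul_mul_tmul]
        rcases Int.even_or_odd i₁ with hi | hi
        swap
        · rw [hS _ hi, Submodule.mem_bot] at hs; simp [hs]
        rcases Int.even_or_odd j₁ with hj | hj
        swap
        · rw [hS _ hj, Submodule.mem_bot] at ht; simp [ht]
        rw [S.graded_comm _ _ s hs t ht, A.graded_comm _ _ a ha b hb,
          Int.negOnePow_even _ (hi.mul_right _), one_smul,
          show (i₁ + i₂) * (j₁ + j₂) = (i₁ * (j₁ + j₂) + i₂ * j₁) + i₂ * j₂ by ring,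
          Int.negOnePow_add,
          Int.negOnePow_even _ ((hi.mul_right _).add (hj.mul_left _)), one_mul]
        simp only [Units.smul_def, TensorProduct.tmul_smul]
  d := A.d.lTensor S
  d_mem := by
    intro i a ha
    induction ha using Submodule.span_induction with
    | zero => rw [map_zero]; exact zero_mem _
    | add a a' _ _ h h' => rw [map_add]; exact add_mem h h'
    | smul q a _ h => rw [map_smul]; exact Submodule.smul_mem _ _ h
    | mem a ha =>
      obtain ⟨i₁, i₂, rfl, s, hs, a, ha, rfl⟩ := ha
      exact Submodule.subset_span ⟨i₁, i₂ - 1, by ring, s, hs, A.d a, A.d_mem _ a ha, rfl⟩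
  d_d := by
    intro a
    induction a with
    | zero => simp
    | add a b ha hb => rw [map_add, map_add, ha, hb, add_zero]
    | tmul s a => simp [A.d_d]
  leibniz := by
    intro i a ha b
    induction ha using Submodule.span_induction with
    | zero => simp
    | add a a' _ _ h h' => simp only [add_mul, map_add, h, h', smul_add]; abel
    | smul q a _ h =>
      simp only [smul_mul_assoc, map_smul, h, smul_add]
      rw [smul_comm q]
    | mem a ha =>
      obtain ⟨i₁, i₂, rfl, s, hs, a, ha, rfl⟩ := ha
      rcases Int.even_or_odd i₁ with hi | hi
      swap
      · rw [hS _ hi, Submodule.mem_bot] at hs; simp [hs]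
      induction b with
      | zero => simp
      | add b b' h h' => simp only [mul_add, map_add, h, h', smul_add]; abel
      | tmul t b =>
        simp only [Algebra.TensorProduct.tmul_mul_tmul, LinearMap.lTensor_tmul,
          A.leibniz _ a ha, TensorProduct.tmul_add, Int.negOnePow_add, Int.negOnePow_even _ hi,
          one_mul, Units.smul_def, TensorProduct.tmul_smul]

/-- The action of `S ⊗_Q A` on `T ⊗_Q X`, with `(s ⊗ a)(t ⊗ x) = st ⊗ ax`. -/
def DGModule.tensorAction {Q : Type u} [CommRing Q] {S A : DGAlgebra Q} (T : DGModule S)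
    (X : DGModule A) : S ⊗[Q] A →ₐ[Q] Module.End Q (T ⊗[Q] X) :=
  Module.endTensorEndAlgHom.comp
    (Algebra.TensorProduct.map (Algebra.lsmul Q Q T) (Algebra.lsmul Q Q X))

theorem DGModule.tensorAction_tmul {Q : Type u} [CommRing Q] {S A : DGAlgebra Q} (T : DGModule S)
    (X : DGModule A) (s : S) (a : A) (t : T) (x : X) :
    T.tensorAction X (s ⊗ₜ a) (t ⊗ₜ x) = (s • t) ⊗ₜ (a • x) := rfl

theorem DGModule.tensorAction_mem {Q : Type u} [CommRing Q] {S A : DGAlgebra Q} (T : DGModule S)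
    (X : DGModule A) (i j : ℤ) (a : S ⊗[Q] A) (ha : a ∈ tensorGrading S.gr A.gr i)
    (b : T ⊗[Q] X) (hb : b ∈ tensorGrading T.gr X.gr j) :
    T.tensorAction X a b ∈ tensorGrading T.gr X.gr (i + j) := by
  induction ha using Submodule.span_induction with
  | zero => rw [map_zero]; exact zero_mem _
  | add a a' _ _ h h' => rw [map_add]; exact add_mem h h'
  | smul q a _ h => rw [map_smul]; exact Submodule.smul_mem _ _ h
  | mem a ha =>
    obtain ⟨i₁, i₂, rfl, s, hs, a, ha, rfl⟩ := ha
    induction hb using Submodule.span_induction with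
    | zero => rw [map_zero]; exact zero_mem _
    | add a a' _ _ h h' => rw [map_add]; exact add_mem h h'
    | smul q a _ h => rw [map_smul]; exact Submodule.smul_mem _ _ h
    | mem b hb =>
      obtain ⟨j₁, j₂, rfl, t, ht, b, hb, rfl⟩ := hb
      exact Submodule.subset_span ⟨i₁ + j₁, i₂ + j₂, by ring, s • t, T.smul_mem _ _ s hs t ht,
        a • b, X.smul_mem _ _ a ha b hb, rfl⟩

theorem DGModule.tensorAction_leibniz {Q : Type u} [CommRing Q] {S A : DGAlgebra Q}
    (hS : S.IsEven) (T : DGModule S) (X : DGModule A) (i : ℤ) (a : S ⊗[Q] A)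
    (ha : a ∈ tensorGrading S.gr A.gr i) (b : T ⊗[Q] X) :
    X.d.lTensor T (T.tensorAction X a b) =
      T.tensorAction X (A.d.lTensor S a) b +
        i.negOnePow • T.tensorAction X a (X.d.lTensor T b) := by
  induction ha using Submodule.span_induction with
  | zero => simp
  | add a a' _ _ h h' =>
    simp only [map_add, LinearMap.add_apply, h, h', smul_add]; abel
  | smul q a _ h =>
    simp only [map_smul, LinearMap.smul_apply, h, smul_add]
    rw [smul_comm q]
  | mem a ha =>
    obtain ⟨i₁, i₂, rfl, s, hs, a, ha, rfl⟩ := ha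
    rcases Int.even_or_odd i₁ with hi | hi
    swap
    · rw [hS _ hi, Submodule.mem_bot] at hs; simp [hs]
    induction b with
    | zero => simp
    | add b b' h h' => simp only [map_add, h, h', smul_add]; abel
    | tmul t b =>
      simp only [LinearMap.lTensor_tmul, DGModule.tensorAction_tmul,
        X.leibniz _ a ha, TensorProduct.tmul_add, Int.negOnePow_add, Int.negOnePow_even _ hi,
        one_mul, Units.smul_def, TensorProduct.tmul_smul]

theorem DGModule.tensorAction_comm {Q : Type u} [CommRing Q] {S A : DGAlgebra Q} (T : DGModule S)
    (X : DGModule A) (w r : S ⊗[Q] A) (x : T ⊗[Q] X) (e : ℤˣ) (h : w * r = e • (r * w)) :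
    T.tensorAction X w (T.tensorAction X r x) =
      e • T.tensorAction X r (T.tensorAction X w x) := by
  rw [← Module.End.mul_apply, ← Module.End.mul_apply, ← map_mul, ← map_mul, h, Units.smul_def,
    Units.smul_def, map_zsmul]
  rfl

/-- The DG `S ⊗_Q A`-module `T ⊗_Q X`, for `S` and `T` concentrated in even degrees. -/
def DGModule.tensor {Q : Type u} [CommRing Q] {S A : DGAlgebra Q} (hS : S.IsEven)
    (T : DGModule S) (_hT : T.IsEven) (X : DGModule A) : DGModule (S.tensor hS A) :=
  letI : Module (S.tensor hS A) (T ⊗[Q] X) :=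
    Module.compHom (T ⊗[Q] X) (T.tensorAction X : S ⊗[Q] A →+* Module.End Q (T ⊗[Q] X))
  haveI : IsScalarTower Q (S.tensor hS A) (T ⊗[Q] X) := ⟨fun q r z =>
    LinearMap.congr_fun (map_smul (T.tensorAction X) q r) z⟩
  { carrier := T ⊗[Q] X
    gr := tensorGrading T.gr X.gr
    internal := isInternal_tensorGrading _ _ T.internal X.internal
    smul_mem := T.tensorAction_mem X
    d := X.d.lTensor T
    d_mem := by
      intro i a ha
      induction ha using Submodule.span_induction with
      | zero => rw [map_zero]; exact zero_mem _
      | add a a' _ _ h h' => rw [map_add]; exact add_mem h h'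
      | smul q a _ h => rw [map_smul]; exact Submodule.smul_mem _ _ h
      | mem a ha =>
        obtain ⟨i₁, i₂, rfl, s, hs, a, ha, rfl⟩ := ha
        exact Submodule.subset_span ⟨i₁, i₂ - 1, by ring, s, hs, X.d a, X.d_mem _ a ha, rfl⟩
    d_d := by
      intro a
      induction a with
      | zero => simp
      | add a b ha hb => rw [map_add, map_add, ha, hb, add_zero]
      | tmul s a => simp [X.d_d]
    leibniz := T.tensorAction_leibniz hS X }

/-! ### Koszul complexes -/

section Koszul

variable {Q : Type u} [CommRing Q] {κ : Type}

/-- The exterior algebra, graded over `ℤ`. -/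
def exteriorGrading (Q : Type u) [CommRing Q] (V : Type*) [AddCommGroup V] [Module Q V] :
    ℤ → Submodule Q (ExteriorAlgebra Q V)
  | Int.ofNat k => ⋀[Q]^k V
  | Int.negSucc _ => ⊥

theorem isInternal_exteriorGrading (V : Type*) [AddCommGroup V] [Module Q V] :
    DirectSum.IsInternal (exteriorGrading Q V) := by
  have h := DirectSum.Decomposition.isInternal (fun i : ℕ ↦ ⋀[Q]^i V)
  obtain ⟨c, hc⟩ := exists_coaction _ h
  refine isInternal_of_coaction _ ?_
    ((Finsupp.lmapDomain (ExteriorAlgebra Q V) Q Int.ofNat).comp c) ?_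
  · rw [eq_top_iff, ← h.submodule_iSup_eq_top]
    exact iSup_le fun i => le_iSup (exteriorGrading Q V) (Int.ofNat i)
  · rintro (k | k) x hx
    · simp [hc k x hx, Finsupp.mapDomain_single]
    · rw [show x = 0 from hx]; simp

/-- Induction on homogeneous elements of the exterior algebra. -/
theorem exteriorGrading_induction {V : Type*} [AddCommGroup V] [Module Q V]
    {C : ℕ → ExteriorAlgebra Q V → Prop}
    (h0 : ∀ r, C 0 (algebraMap Q _ r))
    (hadd : ∀ k x y, C k x → C k y → C k (x + y))
    (hmul : ∀ k v x, x ∈ ⋀[Q]^k V → C k x → C (k + 1) (ExteriorAlgebra.ι Q v * x))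
    (k : ℕ) (x : ExteriorAlgebra Q V) (hx : x ∈ ⋀[Q]^k V) : C k x := by
  induction hx using Submodule.pow_induction_on_left' with
  | algebraMap r => exact h0 r
  | add x y i _ _ hx hy => exact hadd i x y hx hy
  | mem_mul m hm i x hx ih =>
    obtain ⟨v, rfl⟩ := hm
    exact hmul i v x hx ih

theorem ι_mem_exteriorPower_one {V : Type*} [AddCommGroup V] [Module Q V] (v : V) :
    ExteriorAlgebra.ι Q v ∈ ⋀[Q]^1 V := by
  rw [ExteriorAlgebra.exteriorPower, pow_one]
  exact LinearMap.mem_range_self _ v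

theorem ι_mul_mem_exteriorPower {V : Type*} [AddCommGroup V] [Module Q V] (v : V) (k : ℕ)
    (x : ExteriorAlgebra Q V) (hx : x ∈ ⋀[Q]^k V) :
    ExteriorAlgebra.ι Q v * x ∈ ⋀[Q]^(k + 1) V := by
  rw [ExteriorAlgebra.exteriorPower, pow_succ']
  exact Submodule.mul_mem_mul (LinearMap.mem_range_self _ _) hx

theorem algebraMapInv_ι {V : Type*} [AddCommGroup V] [Module Q V] (v : V) :
    (ExteriorAlgebra.algebraMapInv (ExteriorAlgebra.ι Q v) : Q) = 0 := by
  simp [ExteriorAlgebra.algebraMapInv]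

theorem algebraMapInv_eq_zero {V : Type*} [AddCommGroup V] [Module Q V] (k : ℕ)
    (x : ExteriorAlgebra Q V) (hx : x ∈ ⋀[Q]^(k + 1) V) :
    (ExteriorAlgebra.algebraMapInv x : Q) = 0 := by
  rw [ExteriorAlgebra.exteriorPower, pow_succ'] at hx
  induction hx using Submodule.mul_induction_on' with
  | mem_mul_mem v hv b _ =>
    obtain ⟨v, rfl⟩ := hv
    rw [map_mul, algebraMapInv_ι, zero_mul]
  | add x _ y _ hx hy => rw [map_add, hx, hy, add_zero]

theorem map_mem_exteriorPower {V W : Type*} [AddCommGroup V] [Module Q V] [AddCommGroup W]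
    [Module Q W] (φ : V →ₗ[Q] W) (k : ℕ) (x : ExteriorAlgebra Q V) (hx : x ∈ ⋀[Q]^k V) :
    ExteriorAlgebra.map φ x ∈ ⋀[Q]^k W := by
  refine exteriorGrading_induction
    (C := fun k x => ExteriorAlgebra.map φ x ∈ ⋀[Q]^k W) ?_ ?_ ?_ k x hx
  · intro r
    rw [AlgHom.commutes]
    exact SetLike.algebraMap_mem_graded (fun i : ℕ ↦ ⋀[Q]^i W) r
  · intro k x y hx hy
    rw [map_add]; exact add_mem hx hy
  · intro k v x _ ih
    rw [map_mul, ExteriorAlgebra.map_apply_ι]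
    exact ι_mul_mem_exteriorPower _ _ _ ih

theorem ι_mul_graded_comm {V : Type*} [AddCommGroup V] [Module Q V] (v : V) (k : ℕ)
    (x : ExteriorAlgebra Q V) (hx : x ∈ ⋀[Q]^k V) :
    ExteriorAlgebra.ι Q v * x = (k : ℤ).negOnePow • (x * ExteriorAlgebra.ι Q v) := by
  refine exteriorGrading_induction
    (C := fun k x => ExteriorAlgebra.ι Q v * x =
      (k : ℤ).negOnePow • (x * ExteriorAlgebra.ι Q v)) ?_ ?_ ?_ k x hx
  · intro r
    simp [Algebra.commutes]
  · intro k x y hx hy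
    rw [mul_add, add_mul, hx, hy, smul_add]
  · intro k w x _ ih
    rw [← mul_assoc, eq_neg_of_add_eq_zero_left (ExteriorAlgebra.ι_add_mul_swap v w), neg_mul,
      mul_assoc, ih, Nat.cast_add, Nat.cast_one, Int.negOnePow_succ, mul_assoc, mul_smul_comm,
      Units.neg_smul]

theorem exterior_graded_comm {V : Type*} [AddCommGroup V] [Module Q V] (k l : ℕ)
    (x y : ExteriorAlgebra Q V) (hx : x ∈ ⋀[Q]^k V) (hy : y ∈ ⋀[Q]^l V) :
    x * y = ((k : ℤ) * l).negOnePow • (y * x) := by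
  refine exteriorGrading_induction
    (C := fun k x => x * y = ((k : ℤ) * l).negOnePow • (y * x)) ?_ ?_ ?_ k x hx
  · intro r
    simp [Algebra.commutes]
  · intro k x x' hx hx'
    rw [mul_add, add_mul, hx, hx', smul_add]
  · intro k w x _ ih
    rw [mul_assoc, ih, mul_smul_comm, ← mul_assoc, ι_mul_graded_comm w l y hy, smul_mul_assoc,
      smul_smul, mul_assoc, ← Int.negOnePow_add]
    congr 2
    push_cast
    ring

/-- The `Q`-linear functional `ξ_i ↦ h_i` on the free module with basis `ξ_i`. -/
abbrev koszulFunctional (h : κ → Q) : Module.Dual Q (κ →₀ Q) := Finsupp.linearCombination Q h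

/-- The Koszul differential: the antiderivation of the exterior algebra with `∂ξ_i = h_i`. -/
def koszulD (h : κ → Q) : ExteriorAlgebra Q (κ →₀ Q) →ₗ[Q] ExteriorAlgebra Q (κ →₀ Q) :=
  CliffordAlgebra.contractLeft (Q := (0 : QuadraticForm Q (κ →₀ Q))) (koszulFunctional h)

theorem koszulD_algebraMap (h : κ → Q) (r : Q) : koszulD h (algebraMap Q _ r) = 0 :=
  CliffordAlgebra.contractLeft_algebraMap _ _ r

theorem koszulD_ι_mul (h : κ → Q) (v : κ →₀ Q) (x : ExteriorAlgebra Q (κ →₀ Q)) :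
    koszulD h (ExteriorAlgebra.ι Q v * x) =
      koszulFunctional h v • x - ExteriorAlgebra.ι Q v * koszulD h x :=
  CliffordAlgebra.contractLeft_ι_mul _ _ _

theorem koszulD_mem (h : κ → Q) (k : ℕ) (x : ExteriorAlgebra Q (κ →₀ Q))
    (hx : x ∈ ⋀[Q]^k (κ →₀ Q)) :
    koszulD h x ∈ exteriorGrading Q (κ →₀ Q) ((k : ℤ) - 1) := by
  refine exteriorGrading_induction
    (C := fun k x => koszulD h x ∈ exteriorGrading Q (κ →₀ Q) ((k : ℤ) - 1)) ?_ ?_ ?_ k x hx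
  · intro r
    rw [koszulD_algebraMap]; exact zero_mem _
  · intro k x y hx hy
    rw [map_add]; exact add_mem hx hy
  · intro k v x hx ih
    rw [koszulD_ι_mul, Nat.cast_add, Nat.cast_one, add_sub_cancel_right]
    refine sub_mem (Submodule.smul_mem _ _ hx) ?_
    cases k with
    | zero =>
      have : koszulD h x = 0 := ih
      rw [this, mul_zero]; exact zero_mem _
    | succ k =>
      rw [Nat.cast_add, Nat.cast_one, add_sub_cancel_right] at ih
      exact ι_mul_mem_exteriorPower _ _ _ ih

theorem koszulD_leibniz (h : κ → Q) (k : ℕ) (x y : ExteriorAlgebra Q (κ →₀ Q))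
    (hx : x ∈ ⋀[Q]^k (κ →₀ Q)) :
    koszulD h (x * y) = koszulD h x * y + (k : ℤ).negOnePow • (x * koszulD h y) := by
  refine exteriorGrading_induction
    (C := fun k x => koszulD h (x * y) =
      koszulD h x * y + (k : ℤ).negOnePow • (x * koszulD h y)) ?_ ?_ ?_ k x hx
  · intro r
    rw [koszulD_algebraMap, ← Algebra.smul_def, map_smul, ← Algebra.smul_def]
    simp
  · intro k x x' hx hx'
    simp only [add_mul, map_add, hx, hx', smul_add]; abel
  · intro k v x _ ih
    rw [mul_assoc, koszulD_ι_mul, ih, koszulD_ι_mul, Nat.cast_add, Nat.cast_one,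
      Int.negOnePow_succ, Units.neg_smul, mul_add, sub_mul, mul_smul_comm, mul_assoc, mul_assoc,
      smul_mul_assoc]
    abel

/-- The Koszul complex `Q⟨ξ_i | ∂ξ_i = h_i⟩` on a family `h`: the exterior algebra on the free
module with basis `(ξ_i)`, with `|ξ_i| = 1`. -/
def koszul (h : κ → Q) : DGAlgebra Q where
  carrier := ExteriorAlgebra Q (κ →₀ Q)
  gr := exteriorGrading Q (κ →₀ Q)
  internal := isInternal_exteriorGrading _
  one_mem := SetLike.one_mem_graded (fun i : ℕ ↦ ⋀[Q]^i (κ →₀ Q))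
  mul_mem := by
    rintro (i | i) (j | j) a ha b hb
    · exact SetLike.mul_mem_graded (A := fun i : ℕ ↦ ⋀[Q]^i (κ →₀ Q)) ha hb
    · rw [show b = 0 from hb, mul_zero]; exact zero_mem _
    all_goals rw [show a = 0 from ha, zero_mul]; exact zero_mem _
  graded_comm := by
    rintro (i | i) (j | j) a ha b hb
    · exact exterior_graded_comm i j a b ha hb
    · rw [show b = 0 from hb, mul_zero, zero_mul, smul_zero]
    all_goals rw [show a = 0 from ha, mul_zero, zero_mul, smul_zero]
  d := koszulD h
  d_mem := by
    rintro (i | i) a ha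
    · exact koszulD_mem h i a ha
    · rw [show a = 0 from ha, map_zero]; exact zero_mem _
  d_d := CliffordAlgebra.contractLeft_contractLeft (Q := (0 : QuadraticForm Q (κ →₀ Q))) _
  leibniz := by
    rintro (i | i) a ha b
    · exact koszulD_leibniz h i a b ha
    · rw [show a = 0 from ha]; simp

/-- The generator `ξ_i` of the Koszul complex. -/
def koszulGen (h : κ → Q) (i : κ) : koszul h :=
  ExteriorAlgebra.ι Q (Finsupp.single i (1 : Q))

theorem koszulGen_mem (h : κ → Q) (i : κ) : koszulGen h i ∈ (koszul h).gr 1 := by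
  exact ι_mem_exteriorPower_one _

theorem koszulGen_sq (h : κ → Q) (i : κ) : koszulGen h i * koszulGen h i = 0 :=
  ExteriorAlgebra.ι_sq_zero _

theorem koszulGen_d (h : κ → Q) (i : κ) :
    (koszul h).d (koszulGen h i) = algebraMap Q (koszul h) (h i) := by
  refine (CliffordAlgebra.contractLeft_ι (Q := (0 : QuadraticForm Q (κ →₀ Q))) _ _).trans ?_
  simp only [koszulFunctional, Finsupp.linearCombination_single, one_smul]
  rfl

theorem map_koszulD {μ : Type} (h : κ → Q) (g : μ → Q) (a : ExteriorAlgebra Q (κ →₀ Q)) :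
    ExteriorAlgebra.map (Finsupp.lmapDomain Q Q (Sum.inl : κ → κ ⊕ μ)) (koszulD h a) =
      koszulD (Sum.elim h g)
        (ExteriorAlgebra.map (Finsupp.lmapDomain Q Q (Sum.inl : κ → κ ⊕ μ)) a) := by
  induction a using CliffordAlgebra.left_induction with
  | algebraMap r =>
    have h1 := koszulD_algebraMap h r
    have h2 := koszulD_algebraMap (Sum.elim h g) r
    rw [h1, AlgHom.commutes, h2, map_zero]
  | add x y hx hy => simp only [map_add, hx, hy]
  | ι_mul x v hx =>
    have h1 := koszulD_ι_mul h v x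
    have h2 := koszulD_ι_mul (Sum.elim h g)
      (Finsupp.lmapDomain Q Q (Sum.inl : κ → κ ⊕ μ) v)
      (ExteriorAlgebra.map (Finsupp.lmapDomain Q Q (Sum.inl : κ → κ ⊕ μ)) x)
    have h3 : koszulFunctional (Sum.elim h g)
        (Finsupp.lmapDomain Q Q (Sum.inl : κ → κ ⊕ μ) v) = koszulFunctional h v := by
      simp [koszulFunctional, Finsupp.linearCombination_mapDomain]
    rw [h3] at h2
    rw [h1, map_sub, map_smul, map_mul, map_mul, ExteriorAlgebra.map_apply_ι, hx, h2]

/-- The inclusion `Q⟨ξ_i | ∂ξ_i = h_i⟩ → Q⟨ξ_i, ζ_j | ∂ξ_i = h_i, ∂ζ_j = g_j⟩`. -/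
def koszulInl {μ : Type} (h : κ → Q) (g : μ → Q) :
    DGAlgebra.Hom (koszul h) (koszul (Sum.elim h g)) where
  map := (ExteriorAlgebra.map (Finsupp.lmapDomain Q Q (Sum.inl : κ → κ ⊕ μ)) :
    ExteriorAlgebra Q (κ →₀ Q) →ₐ[Q] ExteriorAlgebra Q (κ ⊕ μ →₀ Q))
  map_mem := by
    rintro (i | i) a ha
    · exact map_mem_exteriorPower _ i a ha
    · rw [show a = 0 from ha]
      exact map_zero (ExteriorAlgebra.map (Finsupp.lmapDomain Q Q (Sum.inl : κ → κ ⊕ μ)))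
  comm := map_koszulD h g

/-- The augmentation of the Koszul complex composed with the differential. -/
theorem algebraMapInv_koszulD_smul (h : κ → Q) (M : Type*) [AddCommGroup M] [Module Q M]
    (hM : ∀ i, h i ∈ Module.annihilator Q M) (x : ExteriorAlgebra Q (κ →₀ Q)) (m : M) :
    (ExteriorAlgebra.algebraMapInv (koszulD h x) : Q) • m = 0 := by
  induction x using CliffordAlgebra.left_induction with
  | algebraMap r =>
    have h1 := koszulD_algebraMap h r
    rw [h1, map_zero, zero_smul]
  | add x y hx hy => rw [map_add, map_add, add_smul, hx, hy, add_zero]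
  | ι_mul x v _ =>
    have h1 := koszulD_ι_mul h v x
    have h2 := algebraMapInv_ι (Q := Q) v
    have h3 : koszulFunctional h v ∈ Module.annihilator Q M := by
      rw [koszulFunctional, Finsupp.linearCombination_apply]
      exact Submodule.sum_mem _ fun i _ => Ideal.mul_mem_left _ _ (hM i)
    rw [h1, map_sub, map_mul, h2, zero_mul, sub_zero, map_smul, smul_eq_mul, mul_comm, mul_smul,
      Module.mem_annihilator.mp h3 m, smul_zero]

/-- A `Q`-module `M` killed by `h`, as a DG module over the Koszul complex on `h`: it sits in
degree `0`, and the Koszul complex acts through its augmentation `ξ_i ↦ 0`. -/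
def koszulModule (h : κ → Q) (M : Type u) [AddCommGroup M] [Module Q M]
    (hM : ∀ i, h i ∈ Module.annihilator Q M) : DGModule (koszul h) :=
  letI : Module (koszul h) M := Module.compHom M
    ((ExteriorAlgebra.algebraMapInv : ExteriorAlgebra Q (κ →₀ Q) →ₐ[Q] Q) :
      ExteriorAlgebra Q (κ →₀ Q) →+* Q)
  haveI : IsScalarTower Q (koszul h) M := ⟨fun q a m => by
    have := map_smul (ExteriorAlgebra.algebraMapInv : ExteriorAlgebra Q (κ →₀ Q) →ₐ[Q] Q) q a
    exact (congrArg (· • m) this).trans (smul_assoc _ _ m)⟩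
  { carrier := M
    gr := fun i => if i = 0 then ⊤ else ⊥
    internal := by
      refine isInternal_of_coaction _ ?_ (Finsupp.lsingle 0) ?_
      · rw [eq_top_iff]
        exact le_iSup_of_le 0 (by simp)
      · intro i x hx
        by_cases hi : i = 0
        · subst hi; rfl
        · rw [if_neg hi, Submodule.mem_bot] at hx
          simp [hx]
    smul_mem := by
      intro i j a ha x hx
      by_cases hj : j = 0
      swap
      · rw [if_neg hj, Submodule.mem_bot] at hx
        rw [hx, smul_zero]; exact zero_mem _
      subst hj
      rcases i with (_ | k) | k
      · rw [if_pos (by simp)]; trivial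
      · have : a • x = (0 : Q) • x := congrArg (· • x) (algebraMapInv_eq_zero k a ha)
        rw [this, zero_smul]; exact zero_mem _
      · rw [show a = 0 from ha, zero_smul]; exact zero_mem _
    d := 0
    d_mem := fun i x _ => zero_mem _
    d_d := fun _ => rfl
    leibniz := by
      intro i a ha x
      have : (koszul h).d a • x = 0 := algebraMapInv_koszulD_smul h M hM a x
      simp [this] }

end Koszul

/-! ### Graded duals -/

section GradedDual

variable {Q R P : Type*} [CommRing Q] [CommRing R] [Algebra Q R] [CommRing P] [Algebra Q P]
  [Algebra R P] (G : ℤ → Submodule Q P)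

/-- `Hom_R(P, R)_j`: the `R`-linear maps `P → R` of degree `j`, with `R` in degree `0`, i.e.
those vanishing on `P_i` for `i ≠ -j`. -/
def dualPiece (R : Type*) [CommRing R] [Algebra Q R] [Algebra R P] (j : ℤ) :
    Submodule Q (P →ₗ[R] R) where
  carrier := {φ | ∀ i, i ≠ -j → ∀ p ∈ G i, φ p = 0}
  zero_mem' _ _ _ _ := rfl
  add_mem' ha hb i hi p hp := by
    rw [LinearMap.add_apply, ha i hi p hp, hb i hi p hp, add_zero]
  smul_mem' q φ h i hi p hp := by
    rw [LinearMap.smul_apply, h i hi p hp, smul_zero]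

/-- The underlying module of the graded dual `Hom_R(P, R) = ⨁_j Hom_R(P, R)_j`. -/
def gradedDual (R : Type*) [CommRing R] [Algebra Q R] [Algebra R P] : Submodule Q (P →ₗ[R] R) :=
  ⨆ j, dualPiece G R j

/-- The graded dual `Hom_R(P, R) = ⨁_j Hom_R(P, R)_j`. -/
def GradedDual (R : Type*) [CommRing R] [Algebra Q R] [Algebra R P] : Type _ :=
  gradedDual G R

instance (R : Type*) [CommRing R] [Algebra Q R] [Algebra R P] : AddCommGroup (GradedDual G R) :=
  inferInstanceAs (AddCommGroup (gradedDual G R))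

instance (R : Type*) [CommRing R] [Algebra Q R] [Algebra R P] : Module Q (GradedDual G R) :=
  inferInstanceAs (Module Q (gradedDual G R))

/-- The piece of degree `j` of the graded dual. -/
def gradedDualPiece (R : Type*) [CommRing R] [Algebra Q R] [Algebra R P] (j : ℤ) :
    Submodule Q (GradedDual G R) :=
  (dualPiece G R j).submoduleOf (gradedDual G R)

/-- The action of `P` on functionals: `(p φ)(q) = φ(p q)`. -/
def dualAct (Q : Type*) [CommRing Q] [Algebra Q R] (p : P) : (P →ₗ[R] R) →ₗ[Q] (P →ₗ[R] R) where
  toFun φ := φ ∘ₗ LinearMap.mulLeft R p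
  map_add' _ _ := rfl
  map_smul' _ _ := rfl

variable {G}

theorem dualAct_mem_piece
    (hmul : ∀ i j : ℤ, ∀ a ∈ G i, ∀ b ∈ G j, a * b ∈ G (i + j))
    (i j : ℤ) (p : P) (hp : p ∈ G i) (φ : P →ₗ[R] R)
    (hφ : φ ∈ dualPiece G R j) : dualAct Q p φ ∈ dualPiece G R (i + j) := by
  intro k hk q hq
  exact hφ (i + k) (by intro h; apply hk; linarith) (p * q) (hmul i k p hp q hq)

theorem dualAct_mem (hG : DirectSum.IsInternal G)
    (hmul : ∀ i j : ℤ, ∀ a ∈ G i, ∀ b ∈ G j, a * b ∈ G (i + j))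
    (p : P) (φ : P →ₗ[R] R) (hφ : φ ∈ gradedDual G R) :
    dualAct Q p φ ∈ gradedDual G R := by
  have hp : p ∈ ⨆ i, G i := by
    rw [hG.submodule_iSup_eq_top]; trivial
  induction hφ using Submodule.iSup_induction' with
  | zero => rw [map_zero]; exact zero_mem _
  | add a b _ _ ha hb => rw [map_add]; exact add_mem ha hb
  | mem j φ hφ =>
    induction hp using Submodule.iSup_induction' with
    | zero =>
      have : dualAct Q 0 φ = 0 := by ext; simp [dualAct]
      rw [this]; exact zero_mem _
    | add a b _ _ ha hb =>
      have : dualAct Q (a + b) φ = dualAct Q a φ + dualAct Q b φ := by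
        ext; simp [dualAct, add_mul]
      rw [this]; exact add_mem ha hb
    | mem i p hp =>
      exact Submodule.mem_iSup_of_mem (i + j) (dualAct_mem_piece hmul i j p hp φ hφ)

/-- The `P`-module structure of the graded dual. -/
abbrev gradedDualModule (hG : DirectSum.IsInternal G)
    (hmul : ∀ i j : ℤ, ∀ a ∈ G i, ∀ b ∈ G j, a * b ∈ G (i + j))
    (R : Type*) [CommRing R] [Algebra Q R] [Algebra R P] :
    Module P (GradedDual G R) where
  smul p φ := ⟨dualAct Q p φ.1, dualAct_mem hG hmul p φ.1 φ.2⟩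
  one_smul φ := Subtype.ext (LinearMap.ext fun q => congrArg φ.1 (one_mul q))
  mul_smul p p' φ := Subtype.ext (LinearMap.ext fun q => congrArg φ.1
    ((mul_assoc p p' q).trans (mul_left_comm p p' q)))
  smul_zero p := Subtype.ext (map_zero (dualAct Q p))
  smul_add p φ ψ := Subtype.ext (map_add (dualAct Q p) φ.1 ψ.1)
  add_smul p p' φ := Subtype.ext (LinearMap.ext fun q =>
    (congrArg φ.1 (add_mul p p' q)).trans (map_add φ.1 _ _))
  zero_smul φ := Subtype.ext (LinearMap.ext fun q =>
    (congrArg φ.1 (zero_mul q)).trans (map_zero φ.1))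

theorem isInternal_gradedDual (hG : DirectSum.IsInternal G)
    (R : Type*) [CommRing R] [Algebra Q R] [Algebra R P] :
    DirectSum.IsInternal (gradedDualPiece G R) := by
  have h1 : ⨆ j, gradedDualPiece G R j = ⊤ := by
    rw [eq_top_iff]
    rintro ⟨φ, hφ⟩ -
    have hφ' : φ ∈ ⨆ j, dualPiece G R j := hφ
    induction hφ' using Submodule.iSup_induction' with
    | zero => exact zero_mem (⨆ j, gradedDualPiece G R j)
    | add a b ha hb iha ihb =>
      exact add_mem (S := Submodule Q (GradedDual G R)) (iha ha) (ihb hb)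
    | mem j φ hj => exact Submodule.mem_iSup_of_mem (p := gradedDualPiece G R) j hj
  let c : ∀ j, GradedDual G R →ₗ[Q] (G (-j) → R) := fun j =>
    { toFun := fun φ p => φ.1 p.1
      map_add' := fun _ _ => rfl
      map_smul' := fun _ _ => rfl }
  refine isInternal_of_detect (gradedDualPiece G R) h1 c ?_ ?_
  · intro i j h φ hφ
    funext p
    exact hφ (-i) (by simpa using Ne.symm h) p.1 p.2
  · intro j φ hφ h
    refine Subtype.ext (LinearMap.ext fun p => ?_)
    have hp : p ∈ ⨆ i, G i := by
      rw [hG.submodule_iSup_eq_top]; trivial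
    change φ.1 p = 0
    induction hp using Submodule.iSup_induction' with
    | zero => rw [map_zero]
    | add a b _ _ ha hb => rw [map_add, ha, hb, add_zero]
    | mem i p hp =>
      by_cases hi : i = -j
      · subst hi
        exact congrFun h ⟨p, hp⟩
      · exact hφ i hi p hp

theorem dualPiece_odd (hG : DirectSum.IsInternal G)
    (hodd : ∀ i : ℤ, Odd i → G i = ⊥) (j : ℤ) (hj : Odd j) (φ : P →ₗ[R] R)
    (hφ : φ ∈ dualPiece G R j) : φ = 0 := by
  ext p
  have hp : p ∈ ⨆ i, G i := by
    rw [hG.submodule_iSup_eq_top]; trivial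
  induction hp using Submodule.iSup_induction' with
  | zero => simp
  | add a b _ _ ha hb => rw [map_add, map_add, ha, hb]
  | mem i p hp =>
    by_cases h : i = -j
    · rw [hodd i (h ▸ hj.neg), Submodule.mem_bot] at hp
      simp [hp]
    · exact hφ i h p hp

end GradedDual

/-! ### The polynomial ring `P = R[χ_1, …, χ_n]` and its graded dual, for `R = Q/I` -/

section Polynomial

variable {Q : Type u} [CommRing Q] (I : Ideal Q) (n : ℕ)

/-- The grading of `R[χ_1, …, χ_n]` with `|χ_i| = -2`. -/
def polyGrading (i : ℤ) : Submodule Q (MvPolynomial (Fin n) (Q ⧸ I)) :=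
  (MvPolynomial.weightedHomogeneousSubmodule (Q ⧸ I)
    (fun _ : Fin n => (-2 : ℤ)) i).restrictScalars Q

theorem isInternal_polyGrading : DirectSum.IsInternal (polyGrading I n) := by
  let := MvPolynomial.weightedGradedAlgebra (Q ⧸ I) (fun _ : Fin n => (-2 : ℤ))
  exact DirectSum.Decomposition.isInternal
    (MvPolynomial.weightedHomogeneousSubmodule (Q ⧸ I) (fun _ : Fin n => (-2 : ℤ)))

theorem polyGrading_mul_mem (i j : ℤ) (a : MvPolynomial (Fin n) (Q ⧸ I))
    (ha : a ∈ polyGrading I n i) (b : MvPolynomial (Fin n) (Q ⧸ I))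
    (hb : b ∈ polyGrading I n j) : a * b ∈ polyGrading I n (i + j) :=
  MvPolynomial.IsWeightedHomogeneous.mul ha hb

theorem polyGrading_odd (i : ℤ) (hi : Odd i) : polyGrading I n i = ⊥ := by
  rw [eq_bot_iff]
  intro p hp
  rw [Submodule.mem_bot]
  ext m
  by_contra hm
  have h := (hp : MvPolynomial.IsWeightedHomogeneous _ p i) hm
  rw [Finsupp.weight_apply, Finsupp.sum] at h
  rw [← h, ← Int.not_even_iff_odd] at hi
  exact hi (Finset.even_sum _ fun k _ => by simp)

/-- `P = R[χ_1, …, χ_n]`, as a DG `Q`-algebra with zero differential and `|χ_i| = -2`. -/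
def polyDG : DGAlgebra Q where
  carrier := MvPolynomial (Fin n) (Q ⧸ I)
  gr := polyGrading I n
  internal := isInternal_polyGrading I n
  one_mem := MvPolynomial.isWeightedHomogeneous_one _ _
  mul_mem := polyGrading_mul_mem I n
  graded_comm i j a ha b hb := by
    rcases Int.even_or_odd i with hi | hi
    · rw [Int.negOnePow_even _ (hi.mul_right _), one_smul, mul_comm]
    · rw [polyGrading_odd I n i hi, Submodule.mem_bot] at ha
      simp [ha]
  d := 0
  d_mem _ _ _ := zero_mem _
  d_d _ := rfl
  leibniz := by simp

theorem polyDG_isEven : (polyDG I n).IsEven := polyGrading_odd I n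

/-- The variable `χ_i`. -/
def chi (i : Fin n) : polyDG I n := (MvPolynomial.X i : MvPolynomial (Fin n) (Q ⧸ I))

/-- The graded dual `D = Hom_R(P, R)`, as a DG `P`-module with zero differential. -/
def dualDG : DGModule (polyDG I n) :=
  letI : Module (polyDG I n) (GradedDual (polyGrading I n) (Q ⧸ I)) :=
    gradedDualModule (isInternal_polyGrading I n) (polyGrading_mul_mem I n) (Q ⧸ I)
  haveI : IsScalarTower Q (polyDG I n) (GradedDual (polyGrading I n) (Q ⧸ I)) := ⟨fun q p φ =>
    Subtype.ext (LinearMap.ext fun r =>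
      (congrArg φ.1 (smul_mul_assoc (β := MvPolynomial (Fin n) (Q ⧸ I)) q p r)).trans
        (LinearMap.map_smul_of_tower φ.1 q _))⟩
  { carrier := GradedDual (polyGrading I n) (Q ⧸ I)
    gr := gradedDualPiece (polyGrading I n) (Q ⧸ I)
    internal := isInternal_gradedDual (isInternal_polyGrading I n) (Q ⧸ I)
    smul_mem := fun i j p hp φ hφ =>
      dualAct_mem_piece (polyGrading_mul_mem I n) i j p hp φ.1 hφ
    d := 0
    d_mem := fun _ _ _ => zero_mem _
    d_d := fun _ => rfl
    leibniz := fun i p _ φ => by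
      have h1 : (polyDG I n).d p • φ = 0 := zero_smul (polyDG I n) φ
      rw [h1, LinearMap.zero_apply, LinearMap.zero_apply, smul_zero, smul_zero, add_zero] }

theorem dualDG_isEven : (dualDG I n).IsEven := by
  intro j hj
  rw [eq_bot_iff]
  intro φ hφ
  exact Subtype.ext
    (dualPiece_odd (isInternal_polyGrading I n) (polyGrading_odd I n) j hj φ.1 hφ)

/-- `I` annihilates `D`. -/
theorem dualDG_smul_eq_zero (q : Q) (hq : q ∈ I) (φ : dualDG I n) : q • φ = 0 := by
  refine Subtype.ext (LinearMap.ext fun p => ?_)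
  change q • (φ.1 p) = 0
  rw [Algebra.smul_def, Ideal.Quotient.algebraMap_eq, Ideal.Quotient.eq_zero_iff_mem.mpr hq,
    zero_mul]

end Polynomial

/-! ### The perturbations `(D ⊗ F)^δ` -/

section Perturbation

variable {Q : Type u} [CommRing Q]

/-- `∑_i χ_i ⊗ a_i` as an endomorphism of `D ⊗_Q X`, where `a_i ∈ A` acts on `X` by left
multiplication. -/
def chiSum (I : Ideal Q) (n : ℕ) {A : DGAlgebra Q} (X : DGModule A) (a : Fin n → A) :
    (dualDG I n) ⊗[Q] X →ₗ[Q] (dualDG I n) ⊗[Q] X :=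
  ∑ i, TensorProduct.map (Algebra.lsmul Q Q (dualDG I n) (chi I n i)) (Algebra.lsmul Q Q X (a i))

theorem chiSum_eq (I : Ideal Q) (n : ℕ) {A : DGAlgebra Q} (X : DGModule A) (a : Fin n → A) :
    chiSum I n X a = (dualDG I n).tensorAction X (∑ i, chi I n i ⊗ₜ a i) := by
  rw [map_sum]
  rfl

theorem sum_sq_eq_zero {S ι : Type*} [Ring S] (s : Finset ι) (w : ι → S)
    (h0 : ∀ i, w i * w i = 0) (h : ∀ i j, w i * w j + w j * w i = 0) :
    (∑ i ∈ s, w i) * (∑ i ∈ s, w i) = 0 := by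
  classical
  induction s using Finset.induction_on with
  | empty => simp
  | insert i s hi ih =>
    have : w i * (∑ j ∈ s, w j) + (∑ j ∈ s, w j) * w i = 0 := by
      rw [Finset.mul_sum, Finset.sum_mul, ← Finset.sum_add_distrib]
      exact Finset.sum_eq_zero fun j _ => h i j
    rw [Finset.sum_insert hi, add_mul, mul_add, mul_add, h0, ih, zero_add, add_zero, this]

theorem chi_mem (I : Ideal Q) (n : ℕ) (i : Fin n) : chi I n i ∈ (polyDG I n).gr (-2) :=
  MvPolynomial.isWeightedHomogeneous_X _ _ _

variable (I : Ideal Q) (n : ℕ) {A : DGAlgebra Q} (X : DGModule A) (a : Fin n → A)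

theorem chiElt_mem (h1 : ∀ i, a i ∈ A.gr 1) :
    (∑ i, chi I n i ⊗ₜ[Q] a i : polyDG I n ⊗[Q] A) ∈ tensorGrading (polyDG I n).gr A.gr (-1) :=
  Submodule.sum_mem _ fun i _ => Submodule.subset_span
    ⟨-2, 1, by norm_num, chi I n i, chi_mem I n i, a i, h1 i, rfl⟩

theorem chiElt_sq (h1 : ∀ i, a i ∈ A.gr 1) (h2 : ∀ i, a i * a i = 0) :
    (∑ i, chi I n i ⊗ₜ[Q] a i : polyDG I n ⊗[Q] A) * (∑ i, chi I n i ⊗ₜ[Q] a i) = 0 := by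
  refine sum_sq_eq_zero _ _ (fun i => ?_) (fun i j => ?_)
  · rw [Algebra.TensorProduct.tmul_mul_tmul, h2, TensorProduct.tmul_zero]
  · rw [Algebra.TensorProduct.tmul_mul_tmul, Algebra.TensorProduct.tmul_mul_tmul,
      A.graded_comm 1 1 _ (h1 i) _ (h1 j), show chi I n i * chi I n j = chi I n j * chi I n i from
        mul_comm (G := MvPolynomial (Fin n) (Q ⧸ I)) _ _]
    simp [TensorProduct.tmul_neg]

theorem chiSum_isDegreeMap (h1 : ∀ i, a i ∈ A.gr 1) :
    DGModule.IsDegreeMap (DGModule.tensor (polyDG_isEven I n) (dualDG I n) (dualDG_isEven I n) X)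
      (DGModule.tensor (polyDG_isEven I n) (dualDG I n) (dualDG_isEven I n) X) (-1)
      (chiSum I n X a) := by
  rw [chiSum_eq]
  refine ⟨fun i x hx => ?_, fun j r hr x => ?_⟩
  · rw [add_comm]
    exact DGModule.tensorAction_mem (dualDG I n) X (-1) i _ (chiElt_mem I n a h1) x hx
  · exact DGModule.tensorAction_comm (dualDG I n) X _ r x _
      (((polyDG I n).tensor (polyDG_isEven I n) A).graded_comm (-1) j _
        (chiElt_mem I n a h1) r hr)

theorem chiSum_sq (h1 : ∀ i, a i ∈ A.gr 1) (h2 : ∀ i, a i * a i = 0)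
    (x : (dualDG I n) ⊗[Q] X) : chiSum I n X a (chiSum I n X a x) = 0 := by
  rw [chiSum_eq, ← Module.End.mul_apply, ← map_mul, chiElt_sq I n a h1 h2, map_zero,
    LinearMap.zero_apply]

theorem chiSum_cycle (q : Fin n → Q) (hq : ∀ i, q i ∈ I) (h1 : ∀ i, a i ∈ A.gr 1)
    (h3 : ∀ i, A.d (a i) = algebraMap Q A (q i)) (x : (dualDG I n) ⊗[Q] X) :
    X.d.lTensor (dualDG I n) (chiSum I n X a x) +
      chiSum I n X a (X.d.lTensor (dualDG I n) x) = 0 := by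
  induction x with
  | zero => simp
  | add x y hx hy =>
    simp only [map_add]
    rw [add_add_add_comm, hx, hy, add_zero]
  | tmul φ x =>
    simp only [chiSum, LinearMap.sum_apply, map_sum, TensorProduct.map_tmul,
      LinearMap.lTensor_tmul, ← Finset.sum_add_distrib, ← TensorProduct.tmul_add]
    refine Finset.sum_eq_zero fun i _ => ?_
    simp only [Algebra.lsmul_coe]
    rw [X.leibniz 1 _ (h1 i), h3, algebraMap_smul, Int.negOnePow_one, Units.neg_smul, one_smul,
      neg_add_cancel_right, ← TensorProduct.smul_tmul, dualDG_smul_eq_zero I n _ (hq i),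
      TensorProduct.zero_tmul]

/-- The DG `P ⊗_Q A`-module `(D ⊗_Q X)^δ` with `δ = ∑ χ_i ⊗ a_i`, for elements `a_i ∈ A_1` with
`a_i² = 0` and `∂a_i ∈ I`. -/
def perturbedDual (q : Fin n → Q) (hq : ∀ i, q i ∈ I) (h1 : ∀ i, a i ∈ A.gr 1)
    (h2 : ∀ i, a i * a i = 0) (h3 : ∀ i, A.d (a i) = algebraMap Q A (q i)) :
    DGModule ((polyDG I n).tensor (polyDG_isEven I n) A) :=
  (DGModule.tensor (polyDG_isEven I n) (dualDG I n) (dualDG_isEven I n) X).perturb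
    (chiSum I n X a) (chiSum_isDegreeMap I n X a h1) (chiSum_cycle I n X a q hq h1 h3)
    (chiSum_sq I n X a h1 h2)

end Perturbation

/-! ### `Λ`, `B` and strong `Λ`-resolutions -/

section Strong

variable {Q : Type u} [CommRing Q] {n : ℕ}

/-- `Λ = E ⊗_Q E'`, for the Koszul complexes `E` on `f` and `E'` on `f'`; this is the Koszul
complex `Q⟨ξ_i, ξ'_i | ∂ξ_i = f_i, ∂ξ'_i = f'_i⟩` on the concatenation of `f` and `f'`. -/
abbrev Lam (f f' : Fin n → Q) : DGAlgebra Q := koszul (Sum.elim f f')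

/-- `ξ_i ∈ Λ`. -/
abbrev xi (f f' : Fin n → Q) (i : Fin n) : Lam f f' := koszulGen (Sum.elim f f') (Sum.inl i)

/-- `ξ'_i ∈ Λ`. -/
abbrev xi' (f f' : Fin n → Q) (i : Fin n) : Lam f f' := koszulGen (Sum.elim f f') (Sum.inr i)

/-- `B = Λ⟨ζ_{i,j} | ∂ζ_{i,j} = g_{i,j}⟩`. -/
abbrev BAlg (f f' : Fin n → Q) {m : Fin n → ℕ} (g : ∀ i, Fin (m i) → Q) : DGAlgebra Q :=
  koszul (Sum.elim (Sum.elim f f') (fun p : Σ i, Fin (m i) => g p.1 p.2))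

/-- The inclusion `Λ → B`. -/
abbrev lamToB (f f' : Fin n → Q) {m : Fin n → ℕ} (g : ∀ i, Fin (m i) → Q) :
    DGAlgebra.Hom (Lam f f') (BAlg f f' g) :=
  koszulInl (Sum.elim f f') (fun p : Σ i, Fin (m i) => g p.1 p.2)

theorem BAlg_annihilates (f f' : Fin n → Q) {m : Fin n → ℕ} (g : ∀ i, Fin (m i) → Q)
    (I : Ideal Q) (M : Type u) [AddCommGroup M] [Module Q M] [Module (Q ⧸ I) M]
    [IsScalarTower Q (Q ⧸ I) M] (hf : ∀ i, f i ∈ I) (hf' : ∀ i, f' i ∈ I)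
    (hg : ∀ i j, g i j ∈ Module.annihilator Q M) (k) :
    Sum.elim (Sum.elim f f') (fun p : Σ i, Fin (m i) => g p.1 p.2) k ∈
      Module.annihilator Q M := by
  have hI : I ≤ Module.annihilator Q M := by
    intro q hq
    rw [Module.mem_annihilator]
    intro x
    rw [← algebraMap_smul (Q ⧸ I), Ideal.Quotient.algebraMap_eq,
      Ideal.Quotient.eq_zero_iff_mem.mpr hq, zero_smul]
  rcases k with (i | i) | p
  · exact hI (hf i)
  · exact hI (hf' i)
  · exact hg p.1 p.2

/-- A strong `Λ`-resolution of the `R`-module `M`, `R = Q/I`: expressions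
`f_i - f'_i = ∑_j x_{i,j} g_{i,j}` with `x_{i,j} ∈ I` and `g_{i,j} ∈ ann_Q(M)`, and a bounded below
semiprojective resolution `F → M` over `B = Λ⟨ζ_{i,j} | ∂ζ_{i,j} = g_{i,j}⟩`. -/
structure StrongResolution (I : Ideal Q) (f f' : Fin n → Q) (hf : ∀ i, f i ∈ I)
    (hf' : ∀ i, f' i ∈ I) (M : Type u) [AddCommGroup M] [Module Q M] [Module (Q ⧸ I) M]
    [IsScalarTower Q (Q ⧸ I) M] where
  m : Fin n → ℕ
  x : ∀ i, Fin (m i) → Q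
  g : ∀ i, Fin (m i) → Q
  x_mem : ∀ i j, x i j ∈ I
  g_mem : ∀ i j, g i j ∈ Module.annihilator Q M
  sum_eq : ∀ i, f i - f' i = ∑ j, x i j * g i j
  F : DGModule (BAlg f f' g)
  boundedBelow : F.BoundedBelow
  semiprojective : F.IsSemiprojective
  aug : DGModule.Hom F (koszulModule _ M (BAlg_annihilates f f' g I M hf hf' g_mem))
  aug_surjective : Function.Surjective aug.map
  aug_quasiIso : aug.IsQuasiIso

variable {I : Ideal Q} {f f' : Fin n → Q} {hf : ∀ i, f i ∈ I} {hf' : ∀ i, f' i ∈ I}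
  {M : Type u} [AddCommGroup M] [Module Q M] [Module (Q ⧸ I) M] [IsScalarTower Q (Q ⧸ I) M]

/-- `F`, as a DG `Λ`-module. -/
abbrev StrongResolution.FLam (S : StrongResolution I f f' hf hf' M) : DGModule (Lam f f') :=
  S.F.restrictScalars (lamToB f f' S.g)

/-- The DG `P ⊗_Q Λ`-module `(D ⊗_Q F)^δ`, `δ = ∑ χ_i ⊗ λ_i`, where `λ_i` is left multiplication
by `ξ_i`. -/
def StrongResolution.perturbDelta (S : StrongResolution I f f' hf hf' M) :
    DGModule ((polyDG I n).tensor (polyDG_isEven I n) (Lam f f')) :=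
  perturbedDual I n S.FLam (fun i => xi f f' i) f hf
    (fun _ => koszulGen_mem _ _) (fun _ => koszulGen_sq _ _) (fun _ => koszulGen_d _ _)

/-- The DG `P ⊗_Q Λ`-module `(D ⊗_Q F)^ε`, `ε = ∑ χ_i ⊗ λ'_i`, where `λ'_i` is left multiplication
by `ξ'_i`. -/
def StrongResolution.perturbEpsilon (S : StrongResolution I f f' hf hf' M) :
    DGModule ((polyDG I n).tensor (polyDG_isEven I n) (Lam f f')) :=
  perturbedDual I n S.FLam (fun i => xi' f f' i) f' hf'
    (fun _ => koszulGen_mem _ _) (fun _ => koszulGen_sq _ _) (fun _ => koszulGen_d _ _)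

end Strong

end

/-!
Put `w_i = ξ_i - ξ'_i - ∑_j x_{i,j} ζ_{i,j}`, a cycle of `B` with `w_i² = 0`. Since `w_i` kills `M`
and `F → M` is a semiprojective resolution over `B`, multiplication by `w_i` is null-homotopic
through a `B`-linear `σ_1`; as `w_i² = 0`, also `w_i σ_1` is a cycle with zero image in
`Hom(F, M)`, and one obtains inductively `B`-linear `σ_k` of degree `2k`, `σ_0 = 1`, with
`[∂, σ_{k+1}] = w_i σ_k`. Because `χ_i` is locally nilpotent on `D`, the power series
`Φ_i = ∑_k χ_iᵏ ⊗ σ_k` makes sense and is invertible on `D ⊗ F`, and `[∂, Φ_i] = (χ_i ⊗ w_i) Φ_i`.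
The elements `x_{i,j} ∈ I` kill `D`, so `δ - ε = ∑ χ_i ⊗ w_i`. The `Φ_i` commute with the action of
`P ⊗ Λ`, hence with `δ` and `ε`, and `Ψ = ∏ Φ_i` satisfies `(∂ + ε) Ψ = Ψ (∂ + δ)`.
-/

/-! ### Graded modules -/

section Grading

variable {Q : Type*} [CommRing Q] {X : Type*} [AddCommGroup X] [Module Q X]

theorem homogeneous_induction {κ : Type*} [DecidableEq κ] {G : κ → Submodule Q X}
    (hG : DirectSum.IsInternal G) {p : X → Prop} (x : X) (zero : p 0)
    (add : ∀ x y, p x → p y → p (x + y)) (homogeneous : ∀ i, ∀ x ∈ G i, p x) : p x :=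
  Submodule.iSup_induction G (motive := p) (hG.submodule_iSup_eq_top ▸ Submodule.mem_top)
    homogeneous zero add

/-- The sign automorphism `x ↦ (-1)^{e|x|} x` of a graded module. -/
noncomputable def gradedTwist {G : ℤ → Submodule Q X} (hG : DirectSum.IsInternal G) (e : ℤ) :
    X →ₗ[Q] X :=
  DirectSum.toModule Q ℤ X (fun i => ((e * i).negOnePow : ℤ) • (G i).subtype) ∘ₗ
    (LinearEquiv.ofBijective (DirectSum.coeLinearMap G) hG).symm

theorem gradedTwist_apply_of_mem {G : ℤ → Submodule Q X} (hG : DirectSum.IsInternal G) (e : ℤ)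
    {i : ℤ} {x : X} (hx : x ∈ G i) : gradedTwist hG e x = (e * i).negOnePow • x := by
  have decompose : (LinearEquiv.ofBijective (DirectSum.coeLinearMap G) hG).symm x =
      DirectSum.lof Q ℤ (fun i => G i) i ⟨x, hx⟩ := by
    rw [LinearEquiv.symm_apply_eq]
    exact (DirectSum.coeLinearMap_lof G i ⟨x, hx⟩).symm
  rw [gradedTwist, LinearMap.comp_apply, LinearEquiv.coe_coe, decompose, DirectSum.toModule_lof]
  rfl

theorem isInternal_comp_add_right {G : ℤ → Submodule Q X} (hG : DirectSum.IsInternal G) (e : ℤ) :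
    DirectSum.IsInternal fun i => G (i + e) := by
  rw [DirectSum.isInternal_submodule_iff_iSupIndep_and_iSup_eq_top] at hG ⊢
  exact ⟨hG.1.comp (add_left_injective e), (Equiv.addRight e).iSup_comp.trans hG.2⟩

theorem pow_apply_mem_of_forall_mem {p : Module.End Q X} {G : ℤ → Submodule Q X} {e : ℤ}
    (hp : ∀ i, ∀ t ∈ G i, p t ∈ G (i + e)) (k : ℕ) {i : ℤ} {t : X} (ht : t ∈ G i) :
    (p ^ k) t ∈ G (i + k * e) := by
  induction k with
  | zero => rwa [Nat.cast_zero, zero_mul, add_zero, pow_zero, Module.End.one_apply]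
  | succ k ih =>
    rw [pow_succ', Nat.cast_succ, add_one_mul, ← add_assoc]
    exact hp _ _ ih

theorem exists_pow_apply_eq_zero_of_degree_neg {G : ℤ → Submodule Q X}
    (hG : DirectSum.IsInternal G) (hneg : ∀ i < 0, G i = ⊥) {p : Module.End Q X} {e : ℤ}
    (he : e < 0) (hp : ∀ i, ∀ t ∈ G i, p t ∈ G (i + e)) (t : X) : ∃ N, (p ^ N) t = 0 := by
  induction t using homogeneous_induction hG with
  | zero => exact ⟨0, map_zero _⟩
  | add t t' ht ht' =>
    obtain ⟨N, hN⟩ := ht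
    obtain ⟨N', hN'⟩ := ht'
    exact ⟨max N N', by rw [map_add, Module.End.pow_map_zero_of_le (le_max_left N N') hN,
      Module.End.pow_map_zero_of_le (le_max_right N N') hN', add_zero]⟩
  | homogeneous i t ht =>
    have degree_neg : i + (i.toNat + 1 : ℕ) * e < 0 := by
      push_cast
      nlinarith [i.self_le_toNat]
    have h := pow_apply_mem_of_forall_mem hp (i.toNat + 1) ht
    rw [hneg _ degree_neg, Submodule.mem_bot] at h
    exact ⟨_, h⟩

theorem mem_of_injective_of_apply_mem {Y : Type*} [AddCommGroup Y] [Module Q Y] {κ : Type*}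
    [DecidableEq κ] {G : κ → Submodule Q X} {H : κ → Submodule Q Y} (hG : DirectSum.IsInternal G)
    (hH : DirectSum.IsInternal H) {φ : X →ₗ[Q] Y} (hφ : Function.Injective φ)
    (hφG : ∀ i, ∀ x ∈ G i, φ x ∈ H i) {i : κ} {x : X} (hx : φ x ∈ H i) : x ∈ G i := by
  obtain ⟨c, hc⟩ := exists_coaction G hG
  obtain ⟨c', hc'⟩ := exists_coaction H hH
  have coaction_map (z : X) : c' (φ z) = (c z).mapRange φ φ.map_zero := by
    induction z using homogeneous_induction hG with
    | zero => simp only [map_zero, Finsupp.mapRange_zero]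
    | add z z' h h' => rw [map_add, map_add, map_add, h, h', Finsupp.mapRange_add φ.map_add]
    | homogeneous j z hz => rw [hc j z hz, hc' j _ (hφG j z hz), Finsupp.mapRange_single]
  have coaction_mem (z : X) (j : κ) : c z j ∈ G j := by
    induction z using homogeneous_induction hG with
    | zero => rw [map_zero]; exact zero_mem _
    | add z z' h h' => rw [map_add]; exact add_mem h h'
    | homogeneous k z hz =>
      rw [hc k z hz, Finsupp.single_apply]
      split_ifs with hkj
      · exact hkj ▸ hz
      · exact zero_mem _
  have component_eq : φ (c x i) = φ x := by
    rw [← Finsupp.mapRange_apply (hf := φ.map_zero), ← coaction_map, hc' i _ hx,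
      Finsupp.single_eq_same]
  exact hφ component_eq ▸ coaction_mem x i

end Grading

/-! ### Power series in a locally nilpotent endomorphism -/

section TensorEval

variable {Q : Type*} [CommRing Q] {T V : Type*} [AddCommGroup T] [Module Q T]
  [AddCommGroup V] [Module Q V]

theorem finsum_pow_tmul {p : Module.End Q T} {t : T} {N : ℕ} (ht : (p ^ N) t = 0) (v : ℕ → V) :
    ∑ᶠ k, (p ^ k) t ⊗ₜ[Q] v k = ∑ k ∈ Finset.range N, (p ^ k) t ⊗ₜ[Q] v k := by
  refine finsum_eq_sum_of_support_subset _ fun k hk => Finset.mem_coe.2 (Finset.mem_range.2 ?_)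
  by_contra hNk
  rw [not_lt] at hNk
  exact hk (by beta_reduce; rw [Module.End.pow_map_zero_of_le hNk ht, TensorProduct.zero_tmul])

/-- The operator `∑ pᵏ ⊗ σ_k` on `T ⊗ V`, for a locally nilpotent endomorphism `p` of `T`. -/
noncomputable def tensorSeries (p : Module.End Q T) (hp : ∀ t, ∃ N, (p ^ N) t = 0)
    (σ : PowerSeries (Module.End Q V)) : Module.End Q (T ⊗[Q] V) :=
  TensorProduct.lift <| LinearMap.mk₂ Q
    (fun t v => ∑ᶠ k, (p ^ k) t ⊗ₜ PowerSeries.coeff k σ v)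
    (fun t t' v => by
      obtain ⟨N, hN⟩ := hp t
      obtain ⟨N', hN'⟩ := hp t'
      replace hN := Module.End.pow_map_zero_of_le (le_max_left N N') hN
      replace hN' := Module.End.pow_map_zero_of_le (le_max_right N N') hN'
      rw [finsum_pow_tmul hN, finsum_pow_tmul hN',
        finsum_pow_tmul (N := max N N') (by rw [map_add, hN, hN', add_zero])]
      simp only [map_add, TensorProduct.add_tmul, Finset.sum_add_distrib])
    (fun q t v => by
      obtain ⟨N, hN⟩ := hp t
      rw [finsum_pow_tmul hN, finsum_pow_tmul (N := N) (by rw [map_smul, hN, smul_zero])]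
      simp only [map_smul, ← TensorProduct.smul_tmul', Finset.smul_sum])
    (fun t v v' => by
      obtain ⟨N, hN⟩ := hp t
      rw [finsum_pow_tmul hN, finsum_pow_tmul hN, finsum_pow_tmul hN]
      simp only [map_add, TensorProduct.tmul_add, Finset.sum_add_distrib])
    (fun q t v => by
      obtain ⟨N, hN⟩ := hp t
      rw [finsum_pow_tmul hN, finsum_pow_tmul hN]
      simp only [map_smul, TensorProduct.tmul_smul, Finset.smul_sum])

variable {p : Module.End Q T} {hp : ∀ t, ∃ N, (p ^ N) t = 0}

theorem tensorSeries_tmul {t : T} {N : ℕ} (ht : (p ^ N) t = 0) (σ : PowerSeries (Module.End Q V))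
    (v : V) : tensorSeries p hp σ (t ⊗ₜ v) =
      ∑ k ∈ Finset.range N, (p ^ k) t ⊗ₜ PowerSeries.coeff k σ v :=
  finsum_pow_tmul ht _

theorem tensorSeries_C (τ : Module.End Q V) :
    tensorSeries p hp (PowerSeries.C τ) = τ.lTensor T :=
  TensorProduct.ext' fun t v => by
    obtain ⟨N, hN⟩ := hp t
    rw [tensorSeries_tmul (Module.End.pow_map_zero_of_le N.le_succ hN), Finset.sum_range_succ',
      PowerSeries.coeff_zero_C, Finset.sum_eq_zero, zero_add]
    · rfl
    · intro k _
      rw [PowerSeries.coeff_succ_C, LinearMap.zero_apply, TensorProduct.tmul_zero]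

theorem tensorSeries_mul (σ τ : PowerSeries (Module.End Q V)) :
    tensorSeries p hp (σ * τ) = tensorSeries p hp σ * tensorSeries p hp τ :=
  TensorProduct.ext' fun t v => by
    obtain ⟨N, hN⟩ := hp t
    have pow_sub_eq_zero {k : ℕ} (hk : k ∈ Finset.range N) : (p ^ (N - k)) ((p ^ k) t) = 0 := by
      rw [← Module.End.mul_apply, ← pow_add, Nat.sub_add_cancel (Finset.mem_range.1 hk).le, hN]
    rw [Module.End.mul_apply, tensorSeries_tmul hN, tensorSeries_tmul hN, map_sum,
      Finset.sum_congr rfl fun k hk => tensorSeries_tmul (pow_sub_eq_zero hk) _ _,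
      ← Finset.sum_range_diag_flip N fun k l =>
        (p ^ l) ((p ^ k) t) ⊗ₜ[Q] PowerSeries.coeff l σ (PowerSeries.coeff k τ v)]
    refine Finset.sum_congr rfl fun k _ => ?_
    rw [PowerSeries.coeff_mul, ← Finset.Nat.sum_antidiagonal_swap,
      Finset.Nat.sum_antidiagonal_eq_sum_range_succ_mk, LinearMap.sum_apply,
      TensorProduct.tmul_sum]
    refine Finset.sum_congr rfl fun l hl => ?_
    rw [← Module.End.mul_apply (p ^ (k - l)), ← pow_add,
      Nat.sub_add_cancel (Finset.mem_range_succ_iff.1 hl)]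
    rfl

/-- Evaluation of power series over `End V` at a locally nilpotent endomorphism of `T`, as
operators on `T ⊗ V`. -/
noncomputable def tensorEval (p : Module.End Q T) (hp : ∀ t, ∃ N, (p ^ N) t = 0) :
    PowerSeries (Module.End Q V) →+* Module.End Q (T ⊗[Q] V) where
  toFun := tensorSeries p hp
  map_one' := by
    rw [← map_one PowerSeries.C, tensorSeries_C]
    exact LinearMap.lTensor_id T V
  map_zero' := by rw [← map_zero PowerSeries.C, tensorSeries_C, LinearMap.lTensor_zero]
  map_add' σ τ := TensorProduct.ext' fun t v => by
    obtain ⟨N, hN⟩ := hp t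
    simp only [LinearMap.add_apply, tensorSeries_tmul hN, map_add, TensorProduct.tmul_add,
      Finset.sum_add_distrib]
  map_mul' := tensorSeries_mul

theorem tensorEval_tmul {t : T} {N : ℕ} (ht : (p ^ N) t = 0) (σ : PowerSeries (Module.End Q V))
    (v : V) : tensorEval p hp σ (t ⊗ₜ v) =
      ∑ k ∈ Finset.range N, (p ^ k) t ⊗ₜ PowerSeries.coeff k σ v :=
  tensorSeries_tmul (hp := hp) ht σ v

theorem tensorEval_C (τ : Module.End Q V) :
    tensorEval p hp (PowerSeries.C τ) = τ.lTensor T :=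
  tensorSeries_C (hp := hp) τ

theorem tensorEval_X : tensorEval p hp (PowerSeries.X : PowerSeries (Module.End Q V)) =
    p.rTensor V :=
  TensorProduct.ext' fun t v => by
    obtain ⟨N, hN⟩ := hp t
    rw [tensorEval_tmul (Module.End.pow_map_zero_of_le (N.le_add_right 2) hN),
      Finset.sum_eq_single_of_mem 1 (by simp) fun k _ hk => ?_, PowerSeries.coeff_one_X, pow_one]
    · rfl
    · rw [PowerSeries.coeff_X, if_neg hk, LinearMap.zero_apply, TensorProduct.tmul_zero]

theorem isUnit_tensorEval {σ : PowerSeries (Module.End Q V)}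
    (hσ : PowerSeries.constantCoeff σ = 1) : IsUnit (tensorEval p hp σ) :=
  (PowerSeries.isUnit_iff_constantCoeff.2 (hσ ▸ isUnit_one)).map (tensorEval p hp)

theorem commute_tensorEval {q : Module.End Q T} {τ : Module.End Q V}
    {σ : PowerSeries (Module.End Q V)} (hq : Commute q p)
    (hτ : ∀ k, Commute τ (PowerSeries.coeff k σ)) :
    Commute (TensorProduct.map q τ) (tensorEval p hp σ) :=
  TensorProduct.ext' fun t v => by
    obtain ⟨N, hN⟩ := hp t
    have hqN : (p ^ N) (q t) = 0 := by
      rw [← Module.End.mul_apply, ← (hq.pow_right N).eq, Module.End.mul_apply, hN, map_zero]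
    rw [Module.End.mul_apply, Module.End.mul_apply, TensorProduct.map_tmul, tensorEval_tmul hN,
      tensorEval_tmul hqN, map_sum]
    refine Finset.sum_congr rfl fun k _ => ?_
    rw [TensorProduct.map_tmul, ← Module.End.mul_apply, ← Module.End.mul_apply τ,
      (hq.pow_right k).eq, (hτ k).eq]
    rfl

theorem lTensor_mul_tensorEval {d w : Module.End Q V} {σ : PowerSeries (Module.End Q V)}
    (h0 : Commute d (PowerSeries.coeff 0 σ))
    (hsucc : ∀ k, d * PowerSeries.coeff (k + 1) σ =
      PowerSeries.coeff (k + 1) σ * d + w * PowerSeries.coeff k σ) :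
    d.lTensor T * tensorEval p hp σ =
      tensorEval p hp σ * d.lTensor T + TensorProduct.map p w * tensorEval p hp σ := by
  have series_identity : PowerSeries.C d * σ =
      σ * PowerSeries.C d + PowerSeries.X * PowerSeries.C w * σ := by
    ext1 (_ | k)
    · simp only [map_add, PowerSeries.coeff_C_mul, PowerSeries.coeff_mul_C, mul_assoc,
        PowerSeries.coeff_zero_X_mul, add_zero, h0.eq]
    · simp only [map_add, PowerSeries.coeff_C_mul, PowerSeries.coeff_mul_C, mul_assoc,
        PowerSeries.coeff_succ_X_mul, hsucc]
  have map_eq : TensorProduct.map p w =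
      tensorEval p hp (PowerSeries.X * PowerSeries.C w) := by
    rw [map_mul, tensorEval_X, tensorEval_C, Module.End.mul_eq_comp,
      LinearMap.rTensor_comp_lTensor]
  rw [map_eq, ← map_mul, ← tensorEval_C (p := p) (hp := hp), ← map_mul, ← map_mul, ← map_add,
    series_identity]

theorem tensorEval_mem_tensorGrading {G : ℤ → Submodule Q T} {H : ℤ → Submodule Q V} {e : ℤ}
    (hpe : ∀ i, ∀ t ∈ G i, p t ∈ G (i + e)) {σ : PowerSeries (Module.End Q V)}
    (hσ : ∀ (k : ℕ) i, ∀ v ∈ H i, PowerSeries.coeff k σ v ∈ H (i - k * e)) {j : ℤ}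
    {z : T ⊗[Q] V} (hz : z ∈ tensorGrading G H j) : tensorEval p hp σ z ∈ tensorGrading G H j := by
  induction hz using Submodule.span_induction with
  | zero => rw [map_zero]; exact zero_mem _
  | add y z _ _ hy hz => rw [map_add]; exact add_mem hy hz
  | smul r z _ hz => rw [map_smul]; exact Submodule.smul_mem _ _ hz
  | mem z hz =>
    obtain ⟨i, i', rfl, t, ht, v, hv, rfl⟩ := hz
    obtain ⟨N, hN⟩ := hp t
    rw [tensorEval_tmul hN]
    exact sum_mem fun k _ => Submodule.subset_span
      ⟨i + k * e, i' - k * e, by ring, _, pow_apply_mem_of_forall_mem hpe k ht, _,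
        hσ k i' v hv, rfl⟩

end TensorEval

theorem mul_list_prod_of_twisted_comm {R ι : Type*} [Ring R] {d : R} {Φ ω : ι → R}
    (hd : ∀ i, d * Φ i = Φ i * d + ω i * Φ i) (hω : ∀ i j, Commute (ω i) (Φ j)) (l : List ι) :
    d * (l.map Φ).prod = (l.map Φ).prod * d + (l.map ω).sum * (l.map Φ).prod := by
  induction l with
  | nil => simp only [List.map_nil, List.prod_nil, List.sum_nil, mul_one, one_mul, add_zero]
  | cons i l ih =>
    have sum_comm : Commute (l.map ω).sum (Φ i) := by
      refine (Commute.list_sum_right _ _ fun y hy => ?_).symm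
      obtain ⟨j, -, rfl⟩ := List.mem_map.1 hy
      exact (hω j i).symm
    rw [List.map_cons, List.map_cons, List.prod_cons, List.sum_cons, ← mul_assoc, hd, add_mul,
      mul_assoc, ih, mul_add, ← mul_assoc (Φ i) (List.sum _), ← sum_comm.eq]
    noncomm_ring

/-! ### DG modules -/

/-- The automorphism `a ↦ (-1)^{e|a|} a` of a DG algebra, through which `A` acts on the `e`-fold
shift of a DG `A`-module. -/
noncomputable def DGAlgebra.twist {Q : Type u} [CommRing Q] (A : DGAlgebra Q) (e : ℤ) :
    A →ₐ[Q] A :=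
  AlgHom.ofLinearMap (gradedTwist A.internal e)
    (by rw [gradedTwist_apply_of_mem A.internal e A.one_mem, mul_zero, Int.negOnePow_zero,
      one_smul])
    fun a b => by
      induction a using homogeneous_induction A.internal with
      | zero => simp only [zero_mul, map_zero]
      | add a a' h h' => simp only [add_mul, map_add, h, h']
      | homogeneous i a ha =>
        induction b using homogeneous_induction A.internal with
        | zero => simp only [mul_zero, map_zero]
        | add b b' h h' => simp only [mul_add, map_add, h, h']
        | homogeneous j b hb =>
          rw [gradedTwist_apply_of_mem _ _ ha, gradedTwist_apply_of_mem _ _ hb,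
            gradedTwist_apply_of_mem _ _ (A.mul_mem i j a ha b hb), mul_add, Int.negOnePow_add,
            smul_mul_smul_comm]

theorem DGAlgebra.twist_apply_of_mem {Q : Type u} [CommRing Q] (A : DGAlgebra Q) (e : ℤ) {i : ℤ}
    {a : A} (ha : a ∈ A.gr i) : A.twist e a = (e * i).negOnePow • a :=
  gradedTwist_apply_of_mem A.internal e ha

namespace DGModule

variable {Q : Type u} [CommRing Q] {A : DGAlgebra Q}

/-- The shift `X[e]` with `X[e]_i = X_{i+e}`: its differential is `(-1)^e ∂` and `a ∈ A` acts as
`(-1)^{e|a|} a`, so that degree `0` maps into `X[e]` are degree `e` maps into `X`. -/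
noncomputable def shift (X : DGModule A) (e : ℤ) : DGModule A :=
  { carrier := X
    moduleAlg := Module.compHom X (A.twist e : A →+* A)
    tower := by
      let : Module A X := Module.compHom X (A.twist e : A →+* A)
      refine ⟨fun q a x => ?_⟩
      exact (congrArg (X.moduleAlg.smul · x) (map_smul (A.twist e) q a)).trans
        (X.tower.smul_assoc q _ x)
    gr := fun i => X.gr (i + e)
    internal := isInternal_comp_add_right X.internal e
    smul_mem := fun i j a ha x hx => by
      change A.twist e a • x ∈ X.gr (i + j + e)
      rw [A.twist_apply_of_mem e ha, Units.smul_def, smul_assoc, add_assoc]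
      exact zsmul_mem (X.smul_mem i (j + e) a ha x hx) _
    d := (e.negOnePow : ℤ) • X.d
    d_mem := fun i x hx => by
      rw [← add_sub_right_comm]
      exact zsmul_mem (X.d_mem _ x hx) _
    d_d := fun x => by
      simp only [LinearMap.smul_apply, map_zsmul, X.d_d, smul_zero]
    leibniz := fun i a ha x => by
      change (e.negOnePow : ℤ) • X.d (A.twist e a • x) =
        A.twist e (A.d a) • x + i.negOnePow • A.twist e a • (e.negOnePow : ℤ) • X.d x
      rw [A.twist_apply_of_mem e ha, A.twist_apply_of_mem e (A.d_mem i a ha), mul_sub, mul_one,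
        Int.negOnePow_sub]
      simp only [Units.smul_def, smul_assoc, map_zsmul, X.leibniz i a ha, smul_add, smul_smul,
        Units.val_mul, smul_comm a]
      congr 2 <;> ring }

theorem isDegreeMap_shift_iff {P X : DGModule A} {e k : ℤ} {φ : P →ₗ[Q] X} :
    IsDegreeMap P (X.shift e) k φ ↔ IsDegreeMap P X (e + k) φ := by
  refine and_congr (forall₃_congr fun i x _ => ?_) (forall₄_congr fun j a ha x => ?_)
  · change φ x ∈ X.gr (i + k + e) ↔ _
    rw [add_assoc, add_comm k]
  · change φ (a • x) = (k * j).negOnePow • (A.twist e a • φ x) ↔ _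
    rw [A.twist_apply_of_mem e ha, add_mul, add_comm, Int.negOnePow_add, mul_smul]
    simp only [Units.smul_def, smul_assoc]

theorem IsDegreeMap.zero {X Y : DGModule A} {e : ℤ} : IsDegreeMap X Y e 0 :=
  ⟨fun _ _ _ => zero_mem _, fun _ _ _ _ => by
    simp only [LinearMap.zero_apply, smul_zero]⟩

theorem IsDegreeMap.one {X : DGModule A} : IsDegreeMap X X 0 1 :=
  ⟨fun i x hx => by rwa [add_zero], fun j a _ x => by
    rw [zero_mul, Int.negOnePow_zero, one_smul, Module.End.one_apply, Module.End.one_apply]⟩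

theorem IsDegreeMap.sub {X Y : DGModule A} {e : ℤ} {φ ψ : X →ₗ[Q] Y}
    (hφ : IsDegreeMap X Y e φ) (hψ : IsDegreeMap X Y e ψ) : IsDegreeMap X Y e (φ - ψ) :=
  ⟨fun i x hx => sub_mem (hφ.1 i x hx) (hψ.1 i x hx), fun j a ha x => by
    rw [LinearMap.sub_apply, LinearMap.sub_apply, hφ.2 j a ha, hψ.2 j a ha, smul_sub, smul_sub]⟩

theorem IsDegreeMap.units_smul {X Y : DGModule A} {e : ℤ} {φ : X →ₗ[Q] Y}
    (hφ : IsDegreeMap X Y e φ) (u : ℤˣ) : IsDegreeMap X Y e (u • φ) :=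
  ⟨fun i x hx => zsmul_mem (hφ.1 i x hx) _, fun j a ha x => by
    simp only [LinearMap.smul_apply, hφ.2 j a ha, Units.smul_def, smul_comm a]
    rw [smul_comm]⟩

theorem IsDegreeMap.comp {X Y Z : DGModule A} {e e' : ℤ} {ψ : Y →ₗ[Q] Z} {φ : X →ₗ[Q] Y}
    (hψ : IsDegreeMap Y Z e' ψ) (hφ : IsDegreeMap X Y e φ) :
    IsDegreeMap X Z (e' + e) (ψ ∘ₗ φ) :=
  ⟨fun i x hx => by
      rw [add_comm e', ← add_assoc]
      exact hψ.1 _ _ (hφ.1 i x hx),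
    fun j a ha x => by
      rw [LinearMap.comp_apply, LinearMap.comp_apply, hφ.2 j a ha, Units.smul_def, map_zsmul,
        hψ.2 j a ha, ← Units.smul_def, smul_smul, ← Int.negOnePow_add, add_mul, add_comm]⟩

theorem IsDegreeMap.list_prod {X : DGModule A} {l : List (Module.End Q X)}
    (hl : ∀ φ ∈ l, IsDegreeMap X X 0 φ) : IsDegreeMap X X 0 l.prod :=
  List.prod_induction (IsDegreeMap X X 0) (fun _ _ hψ hφ => hψ.comp hφ) .one hl

theorem IsDegreeMap.map_smul_of_even {X Y : DGModule A} {e : ℤ} {φ : X →ₗ[Q] Y}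
    (hφ : IsDegreeMap X Y e φ) (he : Even e) (a : A) (x : X) : φ (a • x) = a • φ x := by
  induction a using homogeneous_induction A.internal with
  | zero => rw [zero_smul, zero_smul, map_zero]
  | add a b ha hb => rw [add_smul, add_smul, map_add, ha, hb]
  | homogeneous i a ha => rw [hφ.2 i a ha, Int.negOnePow_even _ (he.mul_right _), one_smul]

theorem IsDegreeMap.restrictScalars {B : DGAlgebra Q} (θ : DGAlgebra.Hom A B) {X Y : DGModule B}
    {e : ℤ} {φ : X →ₗ[Q] Y} (hφ : IsDegreeMap X Y e φ) :
    IsDegreeMap (X.restrictScalars θ) (Y.restrictScalars θ) e φ :=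
  ⟨hφ.1, fun j a ha x => hφ.2 j (θ.map a) (θ.map_mem j a ha) x⟩

theorem isDegreeMap_lsmul (X : DGModule A) {e : ℤ} {a : A} (ha : a ∈ A.gr e) :
    IsDegreeMap X X e (Algebra.lsmul Q Q X a) :=
  ⟨fun i x hx => add_comm i e ▸ X.smul_mem e i a ha x hx, fun j b hb x => by
    simp only [Algebra.lsmul_coe, ← mul_smul, A.graded_comm e j a ha b hb, Units.smul_def,
      smul_assoc]⟩

/-- The zero morphism of DG modules. -/
def Hom.zero (X Y : DGModule A) : Hom X Y := ⟨0, .zero, fun _ => (map_zero _).symm⟩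

/-- Composition of morphisms of DG modules. -/
def Hom.comp {X Y Z : DGModule A} (β : Hom Y Z) (α : Hom X Y) : Hom X Z where
  map := β.map ∘ₗ α.map
  isDegreeMap := β.isDegreeMap.comp α.isDegreeMap
  comm x := by simp only [LinearMap.comp_apply, α.comm, β.comm]

theorem Hom.isQuasiIso_iff {X Y : DGModule A} (α : Hom X Y) : α.IsQuasiIso ↔
    (∀ x, X.d x = 0 → (∃ y, Y.d y = α.map x) → ∃ x', X.d x' = x) ∧
      ∀ y, Y.d y = 0 → ∃ x, X.d x = 0 ∧ ∃ y', Y.d y' = α.map x - y := by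
  have homologyMap_mk (x : LinearMap.ker X.d) : α.homologyMap (Submodule.Quotient.mk x) =
      Submodule.Quotient.mk (α.cyclesMap x) := rfl
  have injective_iff : Function.Injective α.homologyMap ↔
      ∀ x, X.d x = 0 → (∃ y, Y.d y = α.map x) → ∃ x', X.d x' = x := by
    rw [injective_iff_map_eq_zero, (Submodule.Quotient.mk_surjective _).forall, Subtype.forall]
    simp only [homologyMap_mk, Submodule.Quotient.mk_eq_zero]
    rfl
  have surjective_iff : Function.Surjective α.homologyMap ↔
      ∀ y, Y.d y = 0 → ∃ x, X.d x = 0 ∧ ∃ y', Y.d y' = α.map x - y := by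
    rw [Function.Surjective, (Submodule.Quotient.mk_surjective _).forall, Subtype.forall]
    simp only [(Submodule.Quotient.mk_surjective _).exists, homologyMap_mk,
      Submodule.Quotient.eq, Subtype.exists]
    exact forall₂_congr fun y _ => exists_congr fun x =>
      ⟨fun ⟨hx, h⟩ => ⟨hx, h⟩, fun ⟨hx, h⟩ => ⟨hx, h⟩⟩
  exact and_congr injective_iff surjective_iff

/-- The morphism `X[e] → Y[e]` with the same underlying map as `γ`. -/
noncomputable def Hom.shift {X Y : DGModule A} (γ : Hom X Y) (e : ℤ) :
    Hom (X.shift e) (Y.shift e) where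
  map := γ.map
  isDegreeMap := ⟨fun i x hx => by
      have h := γ.isDegreeMap.1 _ x hx
      rwa [add_right_comm] at h, fun j a _ x => by
      rw [zero_mul, Int.negOnePow_zero, one_smul]
      exact γ.isDegreeMap.map_smul_of_even Even.zero (A.twist e a) x⟩
  comm x := (map_zsmul γ.map _ (X.d x)).trans (congrArg (_ • ·) (γ.comm x))

theorem Hom.IsQuasiIso.shift {X Y : DGModule A} {γ : Hom X Y} (hγ : γ.IsQuasiIso) (e : ℤ) :
    (γ.shift e).IsQuasiIso := by
  rw [Hom.isQuasiIso_iff] at hγ ⊢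
  have d_eq_zero (Z : DGModule A) (z : Z) : (Z.shift e).d z = 0 ↔ Z.d z = 0 :=
    smul_eq_zero_iff_eq (α := ℤˣ) e.negOnePow
  have exists_d (Z : DGModule A) (z : Z) : (∃ y, (Z.shift e).d y = z) ↔ ∃ y, Z.d y = z := by
    refine ⟨fun ⟨y, hy⟩ => ⟨e.negOnePow • (show Z from y), (map_zsmul Z.d _ _).trans hy⟩,
      fun ⟨y, hy⟩ => ⟨e.negOnePow • (show Z from y), ?_⟩⟩
    rw [← hy]
    change (e.negOnePow : ℤ) • Z.d ((e.negOnePow : ℤ) • y) = _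
    rw [map_zsmul, smul_smul, ← Units.val_mul, Int.units_mul_self, Units.val_one, one_smul]
  exact ⟨fun x hx hy => (exists_d X x).2 (hγ.1 x ((d_eq_zero X x).1 hx) ((exists_d Y _).1 hy)),
    fun y hy => (hγ.2 y ((d_eq_zero Y y).1 hy)).imp fun x hx =>
      ⟨(d_eq_zero X x).2 hx.1, (exists_d Y _).2 hx.2⟩⟩

theorem IsSemiprojective.homotopic {P X Y : DGModule A} (hP : P.IsSemiprojective) {γ : Hom X Y}
    (hγ : Function.Surjective γ.map) (hγ' : γ.IsQuasiIso) {β β' : Hom P X}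
    (h : ∀ x, γ.map (β.map x) = γ.map (β'.map x)) : ∃ τ : P →ₗ[Q] X, IsDegreeMap P X 1 τ ∧
      ∀ x, X.d (τ x) + τ (P.d x) = β.map x - β'.map x := by
  obtain ⟨lift, -, homotopic_lift⟩ := hP X Y (γ.comp β) γ hγ hγ'
  obtain ⟨τ, τ_deg, hτ⟩ := homotopic_lift β fun _ => rfl
  obtain ⟨τ', τ'_deg, hτ'⟩ := homotopic_lift β' fun x => (h x).symm
  refine ⟨τ - τ', τ_deg.sub τ'_deg, fun x => ?_⟩
  rw [LinearMap.sub_apply, LinearMap.sub_apply, map_sub, sub_add_sub_comm, hτ, hτ',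
    sub_sub_sub_cancel_right]

/-- Over a semiprojective `P`, the kernel of `Hom(P, X) → Hom(P, Y)` is acyclic whenever `X → Y`
is a surjective quasi-isomorphism. -/
theorem IsSemiprojective.exists_boundary {P X Y : DGModule A} (hP : P.IsSemiprojective)
    {γ : Hom X Y} (hγ : Function.Surjective γ.map) (hγ' : γ.IsQuasiIso) {e : ℤ}
    {ψ : P →ₗ[Q] X} (hψ : IsDegreeMap P X e ψ) (hcyc : ∀ x, X.d (ψ x) = e.negOnePow • ψ (P.d x))
    (hzero : ∀ x, γ.map (ψ x) = 0) :
    ∃ σ : P →ₗ[Q] X, IsDegreeMap P X (e + 1) σ ∧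
      ∀ x, X.d (σ x) + e.negOnePow • σ (P.d x) = ψ x := by
  let ψ' : Hom P (X.shift e) :=
    { map := ψ
      isDegreeMap := isDegreeMap_shift_iff.2 (by rwa [add_zero])
      comm := fun x => by
        change ψ (P.d x) = e.negOnePow • X.d (ψ x)
        rw [hcyc, smul_smul, Int.units_mul_self, one_smul] }
  obtain ⟨τ, τ_deg, hτ⟩ : ∃ τ : P →ₗ[Q] X, IsDegreeMap P (X.shift e) 1 τ ∧
      ∀ x, e.negOnePow • X.d (τ x) + τ (P.d x) = ψ x - 0 :=
    hP.homotopic (γ := γ.shift e) (β := ψ') (β' := .zero P (X.shift e)) hγ (hγ'.shift e)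
      fun x => (hzero x).trans (map_zero γ.map).symm
  refine ⟨e.negOnePow • τ, (isDegreeMap_shift_iff.1 τ_deg).units_smul _, fun x => ?_⟩
  rw [LinearMap.smul_apply, LinearMap.smul_apply, smul_smul, Int.units_mul_self, one_smul,
    Units.smul_def, map_zsmul, ← Units.smul_def, hτ, sub_zero]

theorem Hom.nonempty_iso_of_bijective {X Y : DGModule A} (α : Hom X Y)
    (hα : Function.Bijective α.map) : Nonempty (Iso X Y) := by
  let e := LinearEquiv.ofBijective α.map hα
  have map_smul (a : A) (x : X) : e (a • x) = a • e x :=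
    α.isDegreeMap.map_smul_of_even Even.zero a x
  refine ⟨⟨α, ⟨e.symm, ⟨fun i y hy => ?_, fun j a _ y => ?_⟩, fun y => ?_⟩, e.symm_apply_apply,
    e.apply_symm_apply⟩⟩
  · rw [add_zero]
    refine mem_of_injective_of_apply_mem X.internal Y.internal hα.1 (fun i x hx => ?_)
      ((e.apply_symm_apply y).symm ▸ hy)
    simpa only [add_zero] using α.isDegreeMap.1 i x hx
  · rw [zero_mul, Int.negOnePow_zero, one_smul, LinearEquiv.coe_coe, LinearEquiv.symm_apply_eq,
      map_smul, e.apply_symm_apply]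
  · rw [LinearEquiv.coe_coe, LinearEquiv.symm_apply_eq]
    exact (congrArg Y.d (e.apply_symm_apply y)).symm.trans (α.comm _).symm

theorem nonempty_iso_perturb {X : DGModule A} {δ ε : Module.End Q X} (hδ hcyc hsq hε hcyc' hsq')
    {Φ : Module.End Q X} (hΦ : IsUnit Φ) (hΦ0 : IsDegreeMap X X 0 Φ)
    (comm : (X.d + ε) * Φ = Φ * (X.d + δ)) :
    Nonempty (Iso (X.perturb δ hδ hcyc hsq) (X.perturb ε hε hcyc' hsq')) :=
  Hom.nonempty_iso_of_bijective ⟨Φ, hΦ0, fun x => (LinearMap.congr_fun comm x).symm⟩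
    ((Module.End.isUnit_iff Φ).1 hΦ)

/-- A power series `σ = ∑ σ_k χᵏ` over `Hom_A(X, X)`, with `χ` of degree `-2`, which has degree `0`
and constant coefficient `1` and satisfies `[∂, σ] = χ w σ`. -/
structure IsHomotopySeries (X : DGModule A) (w : Module.End Q X)
    (σ : PowerSeries (Module.End Q X)) : Prop where
  constantCoeff_eq_one : PowerSeries.constantCoeff σ = 1
  isDegreeMap_coeff : ∀ k : ℕ, IsDegreeMap X X (2 * k) (PowerSeries.coeff k σ)
  comm_coeff : ∀ (k : ℕ) (x : X), X.d (PowerSeries.coeff (k + 1) σ x) -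
    PowerSeries.coeff (k + 1) σ (X.d x) = w (PowerSeries.coeff k σ x)

theorem IsHomotopySeries.restrictScalars {B : DGAlgebra Q} (θ : DGAlgebra.Hom A B) {X : DGModule B}
    {w : Module.End Q X} {σ : PowerSeries (Module.End Q X)} (hσ : IsHomotopySeries X w σ) :
    IsHomotopySeries (X.restrictScalars θ) w σ :=
  ⟨hσ.1, fun k => (hσ.2 k).restrictScalars θ, hσ.3⟩

theorem IsSemiprojective.exists_null_homotopy {P Y : DGModule A} (hP : P.IsSemiprojective)
    {γ : Hom P Y} (hγ : Function.Surjective γ.map) (hγ' : γ.IsQuasiIso) {w : A}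
    (hw : w ∈ A.gr 1) (hdw : A.d w = 0) (hwY : ∀ y : Y, w • y = 0) {e : ℤ} (he : Even e)
    {φ : P →ₗ[Q] P} (hφ : IsDegreeMap P P e φ) (hcyc : ∀ x, w • P.d (φ x) = w • φ (P.d x)) :
    ∃ σ : P →ₗ[Q] P, IsDegreeMap P P (e + 2) σ ∧ ∀ x, P.d (σ x) - σ (P.d x) = w • φ x := by
  have odd_sign : (1 + e).negOnePow = -1 := Int.negOnePow_odd _ he.one_add
  obtain ⟨σ, σ_deg, hσ⟩ := hP.exists_boundary hγ hγ' ((isDegreeMap_lsmul P hw).comp hφ)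
    (fun x => by
      change P.d (w • φ x) = (1 + e).negOnePow • (w • φ (P.d x))
      rw [P.leibniz 1 w hw, hdw, zero_smul, zero_add, hcyc, odd_sign, Int.negOnePow_one])
    (fun x => (γ.isDegreeMap.map_smul_of_even Even.zero w (φ x)).trans (hwY _))
  refine ⟨σ, ?_, fun x => ?_⟩
  · rwa [add_right_comm, one_add_one_eq_two, add_comm 2] at σ_deg
  · have h := hσ x
    rwa [odd_sign, Units.neg_smul, one_smul, ← sub_eq_add_neg] at h

theorem IsSemiprojective.exists_homotopySeries {P Y : DGModule A} (hP : P.IsSemiprojective)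
    {γ : Hom P Y} (hγ : Function.Surjective γ.map) (hγ' : γ.IsQuasiIso) {w : A}
    (hw : w ∈ A.gr 1) (hww : w * w = 0) (hdw : A.d w = 0) (hwY : ∀ y : Y, w • y = 0) :
    ∃ σ, IsHomotopySeries P (Algebra.lsmul Q Q P w) σ := by
  let Good (k : ℕ) (φ : Module.End Q P) : Prop :=
    IsDegreeMap P P (2 * k) φ ∧ ∀ x, w • P.d (φ x) = w • φ (P.d x)
  have step (k : ℕ) (φ : Module.End Q P) (hφ : Good k φ) : ∃ σ : Module.End Q P,
      Good (k + 1) σ ∧ ∀ x, P.d (σ x) - σ (P.d x) = w • φ x := by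
    obtain ⟨σ, σ_deg, hσ⟩ := hP.exists_null_homotopy hγ hγ' hw hdw hwY (even_two_mul _) hφ.1 hφ.2
    refine ⟨σ, ⟨?_, fun x => ?_⟩, hσ⟩
    · rwa [Nat.cast_succ, mul_add, mul_one]
    · rw [← sub_eq_zero, ← smul_sub, hσ, ← mul_smul, hww, zero_smul]
  choose! next good_next hnext using step
  let σ (k : ℕ) : Module.End Q P := Nat.rec 1 next k
  have good (k : ℕ) : Good k (σ k) := by
    induction k with
    | zero => exact ⟨.one, fun _ => rfl⟩
    | succ k ih => exact good_next k _ ih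
  exact ⟨PowerSeries.mk σ, rfl, fun k => by simpa only [PowerSeries.coeff_mk] using (good k).1,
    fun k x => by
      simpa only [PowerSeries.coeff_mk, Algebra.lsmul_coe] using hnext k _ (good k) x⟩

end DGModule

/-! ### Perturbations of `D ⊗ X` -/

section DualPolynomial

variable {Q : Type u} [CommRing Q] (I : Ideal Q) (n : ℕ)

theorem polyGrading_eq_bot_of_pos {i : ℤ} (hi : 0 < i) : polyGrading I n i = ⊥ := by
  refine (Submodule.eq_bot_iff _).2 fun p hp => MvPolynomial.ext _ _ fun m => ?_
  by_contra hm
  have weight_eq : Finsupp.weight (fun _ => (-2 : ℤ)) m = i :=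
    (hp : MvPolynomial.IsWeightedHomogeneous _ p i) hm
  have weight_nonpos : Finsupp.weight (fun _ => (-2 : ℤ)) m ≤ 0 := by
    rw [Finsupp.weight_apply]
    exact Finset.sum_nonpos fun a _ => nsmul_nonpos (by decide) _
  exact absurd weight_eq (weight_nonpos.trans_lt hi).ne

theorem dualDG_gr_eq_bot_of_neg {j : ℤ} (hj : j < 0) : (dualDG I n).gr j = ⊥ := by
  refine (Submodule.eq_bot_iff _).2 fun φ hφ => Subtype.ext (LinearMap.ext fun p => ?_)
  change φ.1 p = 0
  induction p using homogeneous_induction (isInternal_polyGrading I n) with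
  | zero => rw [map_zero]
  | add p p' hp hp' => rw [map_add, hp, hp', add_zero]
  | homogeneous i p hp =>
    obtain rfl | hi := eq_or_ne i (-j)
    · rw [polyGrading_eq_bot_of_pos I n (neg_pos.2 hj), Submodule.mem_bot] at hp
      rw [hp, map_zero]
    · exact hφ i hi p hp

/-- The endomorphism of `D` given by `χ_i`. -/
noncomputable def chiEnd (i : Fin n) : Module.End Q (dualDG I n) :=
  Algebra.lsmul Q Q (dualDG I n) (chi I n i)

theorem chiEnd_apply_mem (i : Fin n) (j : ℤ) (φ : dualDG I n) (hφ : φ ∈ (dualDG I n).gr j) :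
    chiEnd I n i φ ∈ (dualDG I n).gr (j + -2) := by
  rw [add_comm]
  exact (dualDG I n).smul_mem _ _ _ (chi_mem I n i) φ hφ

theorem exists_chiEnd_pow_apply_eq_zero (i : Fin n) (φ : dualDG I n) :
    ∃ N, (chiEnd I n i ^ N) φ = 0 :=
  exists_pow_apply_eq_zero_of_degree_neg (dualDG I n).internal
    (fun _ => dualDG_gr_eq_bot_of_neg I n) (by decide) (chiEnd_apply_mem I n i) φ

theorem commute_lsmul_chiEnd (p : polyDG I n) (i : Fin n) :
    Commute (Algebra.lsmul Q Q (dualDG I n) p) (chiEnd I n i) :=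
  have hp : Commute p (chi I n i) := mul_comm (G := MvPolynomial (Fin n) (Q ⧸ I)) _ _
  hp.map (Algebra.lsmul Q Q (dualDG I n))

end DualPolynomial

section Perturbation

variable {Q : Type u} [CommRing Q] (I : Ideal Q) {n : ℕ} {A : DGAlgebra Q}

/-- The operator `∑ χ_iᵏ ⊗ σ_k` on `D ⊗ V`. -/
noncomputable def chiEval {V : Type*} [AddCommGroup V] [Module Q V] (i : Fin n) :
    PowerSeries (Module.End Q V) →+* Module.End Q (dualDG I n ⊗[Q] V) :=
  tensorEval (chiEnd I n i) (exists_chiEnd_pow_apply_eq_zero I n i)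

/-- The unperturbed DG `P ⊗_Q A`-module `D ⊗_Q X`. -/
noncomputable abbrev dualTensor (n : ℕ) (X : DGModule A) :
    DGModule ((polyDG I n).tensor (polyDG_isEven I n) A) :=
  DGModule.tensor (polyDG_isEven I n) (dualDG I n) (dualDG_isEven I n) X

namespace DGModule

variable {X : DGModule A} {w : Module.End Q X} {σ : PowerSeries (Module.End Q X)}

theorem IsHomotopySeries.commute_tensorAction_chiEval (hσ : IsHomotopySeries X w σ) (i : Fin n)
    (r : polyDG I n ⊗[Q] A) : Commute ((dualDG I n).tensorAction X r) (chiEval I i σ) := by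
  induction r with
  | zero => rw [map_zero]; exact Commute.zero_left _
  | add r s hr hs => rw [map_add]; exact hr.add_left hs
  | tmul p a =>
    exact commute_tensorEval (commute_lsmul_chiEnd I n p i) fun k => LinearMap.ext fun x =>
      ((hσ.isDegreeMap_coeff k).map_smul_of_even (even_two_mul _) a x).symm

theorem IsHomotopySeries.isDegreeMap_chiEval (hσ : IsHomotopySeries X w σ) (i : Fin n) :
    IsDegreeMap (dualTensor I n X) (dualTensor I n X) 0 (chiEval I i σ) := by
  refine ⟨fun j z hz => ?_, fun j r _ z => ?_⟩
  · rw [add_zero]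
    refine tensorEval_mem_tensorGrading (chiEnd_apply_mem I n i) (fun k j x hx => ?_) hz
    rw [mul_neg, sub_neg_eq_add, mul_comm]
    exact (hσ.isDegreeMap_coeff k).1 j x hx
  · rw [zero_mul, Int.negOnePow_zero, one_smul]
    exact (LinearMap.congr_fun (hσ.commute_tensorAction_chiEval I i r).eq z).symm

theorem IsHomotopySeries.lTensor_d_mul_chiEval (hσ : IsHomotopySeries X w σ) (i : Fin n) :
    X.d.lTensor (dualDG I n) * chiEval I i σ = chiEval I i σ * X.d.lTensor (dualDG I n) +
      TensorProduct.map (chiEnd I n i) w * chiEval I i σ := by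
  refine lTensor_mul_tensorEval ?_ fun k => LinearMap.ext fun x => ?_
  · rw [PowerSeries.coeff_zero_eq_constantCoeff_apply, hσ.constantCoeff_eq_one]
    exact Commute.one_right _
  · exact sub_eq_iff_eq_add'.1 (hσ.comm_coeff k x)

end DGModule

variable {I}

theorem map_chiEnd_eq_tensorAction_sub {X : DGModule A} {a b : A} {w : Module.End Q X}
    (hw : ∀ (ψ : dualDG I n) (x : X), ψ ⊗ₜ[Q] (a • x) - ψ ⊗ₜ[Q] (b • x) = ψ ⊗ₜ[Q] w x)
    (i : Fin n) : TensorProduct.map (chiEnd I n i) w =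
      (dualDG I n).tensorAction X (chi I n i ⊗ₜ a) -
        (dualDG I n).tensorAction X (chi I n i ⊗ₜ b) :=
  TensorProduct.ext' fun ψ x => (hw (chi I n i • ψ) x).symm

theorem exists_isUnit_lTensor_d_mul {X : DGModule A} {w : Fin n → Module.End Q X}
    {σ : Fin n → PowerSeries (Module.End Q X)}
    (hσ : ∀ i, DGModule.IsHomotopySeries X (w i) (σ i))
    (hw : ∀ i j, Commute (TensorProduct.map (chiEnd I n i) (w i)) (chiEval I j (σ j))) :
    ∃ Ψ : Module.End Q (dualDG I n ⊗[Q] X), IsUnit Ψ ∧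
      DGModule.IsDegreeMap (dualTensor I n X) (dualTensor I n X) 0 Ψ ∧
      X.d.lTensor (dualDG I n) * Ψ = Ψ * X.d.lTensor (dualDG I n) +
        (∑ i, TensorProduct.map (chiEnd I n i) (w i)) * Ψ := by
  refine ⟨((List.finRange n).map fun i => chiEval I i (σ i)).prod,
    List.prod_isUnit (List.forall_mem_map.2 fun i _ =>
      isUnit_tensorEval (hσ i).constantCoeff_eq_one),
    DGModule.IsDegreeMap.list_prod (X := dualTensor I n X)
      (List.forall_mem_map.2 fun i _ => (hσ i).isDegreeMap_chiEval I i), ?_⟩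
  rw [Fin.sum_univ_def]
  exact mul_list_prod_of_twisted_comm (fun i => (hσ i).lTensor_d_mul_chiEval I i) hw _

theorem nonempty_iso_perturbedDual {X : DGModule A} {a b : Fin n → A}
    {w : Fin n → Module.End Q X} {σ : Fin n → PowerSeries (Module.End Q X)}
    (hw : ∀ (i : Fin n) (ψ : dualDG I n) (x : X),
      ψ ⊗ₜ[Q] (a i • x) - ψ ⊗ₜ[Q] (b i • x) = ψ ⊗ₜ[Q] w i x)
    (hσ : ∀ i, DGModule.IsHomotopySeries X (w i) (σ i))
    {q : Fin n → Q} (hq : ∀ i, q i ∈ I) (h1 : ∀ i, a i ∈ A.gr 1)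
    (h2 : ∀ i, a i * a i = 0) (h3 : ∀ i, A.d (a i) = algebraMap Q A (q i))
    {q' : Fin n → Q} (hq' : ∀ i, q' i ∈ I) (h1' : ∀ i, b i ∈ A.gr 1)
    (h2' : ∀ i, b i * b i = 0) (h3' : ∀ i, A.d (b i) = algebraMap Q A (q' i)) :
    Nonempty (DGModule.Iso (perturbedDual I n X a q hq h1 h2 h3)
      (perturbedDual I n X b q' hq' h1' h2' h3')) := by
  have sum_eq : ∑ i, TensorProduct.map (chiEnd I n i) (w i) =
      chiSum I n X a - chiSum I n X b := by
    rw [chiSum, chiSum, ← Finset.sum_sub_distrib]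
    exact Finset.sum_congr rfl fun i _ => map_chiEnd_eq_tensorAction_sub (hw i) i
  obtain ⟨Ψ, Ψ_isUnit, Ψ_deg, d_mul⟩ := exists_isUnit_lTensor_d_mul hσ fun i j => by
    rw [map_chiEnd_eq_tensorAction_sub (hw i) i]
    exact ((hσ j).commute_tensorAction_chiEval I j _).sub_left
      ((hσ j).commute_tensorAction_chiEval I j _)
  have Ψ_comm : chiSum I n X a * Ψ = Ψ * chiSum I n X a := LinearMap.ext fun z => by
    rw [chiSum_eq]
    exact (Ψ_deg.map_smul_of_even Even.zero (∑ i, chi I n i ⊗ₜ a i) z).symm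
  refine DGModule.nonempty_iso_perturb _ _ _ _ _ _ Ψ_isUnit Ψ_deg ?_
  change (X.d.lTensor (dualDG I n) + chiSum I n X b) * Ψ =
    Ψ * (X.d.lTensor (dualDG I n) + chiSum I n X a)
  rw [add_mul, d_mul, sum_eq, sub_mul, mul_add, Ψ_comm, add_assoc, sub_add_cancel]

end Perturbation

/-! ### The cycles `w_i` -/

section Koszul

variable {Q : Type u} [CommRing Q] {κ : Type}

theorem koszulInl_koszulGen {μ : Type} (h : κ → Q) (g : μ → Q) (i : κ) :
    (koszulInl h g).map (koszulGen h i) = koszulGen (Sum.elim h g) (Sum.inl i) := by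
  refine (ExteriorAlgebra.map_apply_ι _ _).trans ?_
  rw [Finsupp.lmapDomain_apply, Finsupp.mapDomain_single]
  rfl

theorem koszul_mul_self_eq_zero {h : κ → Q} {a : koszul h} (ha : a ∈ (koszul h).gr 1) :
    a * a = 0 := by
  have ha' : a ∈ (LinearMap.range (ExteriorAlgebra.ι Q : (κ →₀ Q) →ₗ[Q] _)) ^ 1 := ha
  rw [pow_one] at ha'
  obtain ⟨v, rfl⟩ := ha'
  exact ExteriorAlgebra.ι_sq_zero v

theorem koszulModule_smul_eq_zero {h : κ → Q} {M : Type u} [AddCommGroup M] [Module Q M]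
    {hM : ∀ i, h i ∈ Module.annihilator Q M} {a : koszul h} (ha : a ∈ (koszul h).gr 1)
    (y : koszulModule h M hM) : a • y = 0 :=
  (congrArg (fun r : Q => r • (show M from y)) (algebraMapInv_eq_zero 0 a ha)).trans
    (zero_smul Q (show M from y))

end Koszul

section KoszulCycle

variable {Q : Type u} [CommRing Q] {n : ℕ} {I : Ideal Q} {f f' : Fin n → Q}
  {m : Fin n → ℕ} {x g : ∀ i, Fin (m i) → Q}

/-- The element `w_i = ξ_i - ξ'_i - ∑_j x_{i,j} ζ_{i,j}` of `B`, a cycle when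
`f_i - f'_i = ∑_j x_{i,j} g_{i,j}`. -/
noncomputable def koszulCycle (f f' : Fin n → Q) (x g : ∀ i, Fin (m i) → Q) (i : Fin n) :
    BAlg f f' g :=
  koszulGen _ (Sum.inl (Sum.inl i)) - koszulGen _ (Sum.inl (Sum.inr i)) -
    ∑ j, x i j • koszulGen _ (Sum.inr ⟨i, j⟩)

theorem koszulCycle_mem (i : Fin n) : koszulCycle f f' x g i ∈ (BAlg f f' g).gr 1 :=
  sub_mem (sub_mem (koszulGen_mem _ _) (koszulGen_mem _ _))
    (sum_mem fun _ _ => Submodule.smul_mem _ _ (koszulGen_mem _ _))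

theorem d_koszulCycle {i : Fin n} (hsum : f i - f' i = ∑ j, x i j * g i j) :
    (BAlg f f' g).d (koszulCycle f f' x g i) = 0 := by
  simp only [koszulCycle, map_sub, map_sum, map_smul, koszulGen_d, Sum.elim_inl, Sum.elim_inr]
  simp only [Algebra.smul_def, ← map_mul, ← map_sum, ← map_sub]
  rw [← hsum, sub_self, map_zero]

theorem tmul_smul_eq_zero_of_mem {X : Type*} [AddCommGroup X] [Module Q X] {q : Q} (hq : q ∈ I)
    (ψ : dualDG I n) (x : X) : ψ ⊗ₜ[Q] (q • x) = 0 := by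
  rw [← TensorProduct.smul_tmul, dualDG_smul_eq_zero I n q hq, TensorProduct.zero_tmul]

theorem tmul_koszulCycle_smul {i : Fin n} (hx : ∀ j, x i j ∈ I) (F : DGModule (BAlg f f' g))
    (ψ : dualDG I n) (y : F) :
    ψ ⊗ₜ[Q] ((lamToB f f' g).map (xi f f' i) • y) -
      ψ ⊗ₜ[Q] ((lamToB f f' g).map (xi' f f' i) • y) =
        ψ ⊗ₜ[Q] (koszulCycle f f' x g i • y) := by
  have tmul_sum_eq_zero : ψ ⊗ₜ[Q] ((∑ j, x i j • koszulGen
      (Sum.elim (Sum.elim f f') fun p : Σ i, Fin (m i) => g p.1 p.2) (Sum.inr ⟨i, j⟩)) • y) =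
        0 := by
    rw [Finset.sum_smul, TensorProduct.tmul_sum]
    refine Finset.sum_eq_zero fun j _ => ?_
    rw [smul_assoc, tmul_smul_eq_zero_of_mem (hx j)]
  rw [koszulInl_koszulGen, koszulInl_koszulGen, koszulCycle, sub_smul _ (∑ j, _),
    TensorProduct.tmul_sub, tmul_sum_eq_zero, sub_zero, sub_smul, TensorProduct.tmul_sub]

end KoszulCycle

theorem lemma5_general {Q : Type u} [CommRing Q] {n : ℕ} {f f' : Fin n → Q} {I : Ideal Q}
    (hf : ∀ i, f i ∈ I) (hf' : ∀ i, f' i ∈ I) {m : Fin n → ℕ} {x g : ∀ i, Fin (m i) → Q}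
    (hx : ∀ i j, x i j ∈ I) (hsum : ∀ i, f i - f' i = ∑ j, x i j * g i j)
    {F Y : DGModule (BAlg f f' g)} (hF : F.IsSemiprojective) {γ : DGModule.Hom F Y}
    (hγ : Function.Surjective γ.map) (hγ' : γ.IsQuasiIso)
    (hY : ∀ (i : Fin n) (y : Y), koszulCycle f f' x g i • y = 0) :
    Nonempty (DGModule.Iso
      (perturbedDual I n (F.restrictScalars (lamToB f f' g)) (fun i => xi f f' i) f hf
        (fun _ => koszulGen_mem _ _) (fun _ => koszulGen_sq _ _) (fun _ => koszulGen_d _ _))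
      (perturbedDual I n (F.restrictScalars (lamToB f f' g)) (fun i => xi' f f' i) f' hf'
        (fun _ => koszulGen_mem _ _) (fun _ => koszulGen_sq _ _)
        (fun _ => koszulGen_d _ _))) := by
  have exists_series (i : Fin n) :
      ∃ σ, DGModule.IsHomotopySeries F (Algebra.lsmul Q Q F (koszulCycle f f' x g i)) σ :=
    hF.exists_homotopySeries hγ hγ' (koszulCycle_mem i)
      (koszul_mul_self_eq_zero (koszulCycle_mem i)) (d_koszulCycle (hsum i)) (hY i)
  choose σ hσ using exists_series
  exact nonempty_iso_perturbedDual (fun i => tmul_koszulCycle_smul (hx i) F)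
    (fun i => (hσ i).restrictScalars (lamToB f f' g)) hf _ _ _ hf' _ _ _

theorem lemma5 {Q : Type u} [CommRing Q] {n : ℕ} (f f' : Fin n → Q) (I : Ideal Q)
    (hf : ∀ i, f i ∈ I) (hf' : ∀ i, f' i ∈ I)
    (M : Type u) [AddCommGroup M] [Module Q M] [Module (Q ⧸ I) M] [IsScalarTower Q (Q ⧸ I) M]
    (hM : ∀ i, f i - f' i ∈ I * Module.annihilator Q M)
    (S : StrongResolution I f f' hf hf' M) :
    Nonempty (DGModule.Iso S.perturbDelta S.perturbEpsilon) :=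
  lemma5_general hf hf' S.x_mem S.sum_eq S.semiprojective S.aug_surjective S.aug_quasiIso
    fun i => koszulModule_smul_eq_zero (koszulCycle_mem i)
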